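/- Let $\mathfrak H$ be a complex separable Hilbert space with inner product linear in the second argument, $\mathcal F=\bigoplus_{n\ge0}\bigwedge^n\mathfrak H$ its fermionic Fock space, $\mathcal N=\bigoplus_{n\ge 0} n\,\mathrm{Id}$ the particle number operator and $\mathcal P_k=\mathbf 1_{\{\mathcal N=k\}}$ the orthogonal projection onto $\bigwedge^k\mathfrak H$. Let $\mathrm{CAR}[\mathfrak H]$ be the unital $C^*$-subalgebra of $\mathcal B(\mathcal F)$ generated by the creation and annihilation operators $a^*(f),a(f)$, $f\in\mathfrak H$. Let $\omega$ be a quasi-free state on $\mathrm{CAR}[\mathfrak H]$, i.e. a non-negative normalized linear functional such that, for all $e_1,e_2,\dots$ each of which is some $a^*(f)$ or $a(f)$, $\omega(e_1\cdots e_{2p-1})=0$ for all $p\ge1$ and $$\omega(e_1\cdots e_{2p})=\sum_{\pi}(-1)^{\epsilon(\pi)}\prod_{j=1}^p\omega(e_{\pi(2j-1)}e_{\pi(2j)}),$$ where $\epsilon(\pi)$ is the parity of $\pi$ and the sum runs over the permutations $\pi$ of $\{1,\dots,2p\}$ with $\pi(1)<\pi(3)<\cdots<\pi(2p-1)$ and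 $\pi(2j-1)<\pi(2j)$ for all $j$. Let $\gamma$ be the one-particle density matrix of $\omega$, $\langle g,\gamma f\rangle=\omega(a^*(f)a(g))$, and let $\alpha$ be its pairing matrix, $\langle\alpha Jf,g\rangle=\omega(a^*(f)a^*(g))$, where $J:\mathfrak H\to\mathfrak K$ is a fixed antilinear isometry into a complex Hilbert space $\mathfrak K$. Assume that $\gamma$ is trace class and $\alpha=0$. Then $\omega$ is normal: there is $G\ge0$ on $\mathcal F$ with $\mathrm{tr}\,G=1$ and $\omega(A)=\mathrm{tr}(GA)$ for all $A\in\mathrm{CAR}[\mathfrak H]$. Moreover, for every such $G$, writing $\omega(B):=\mathrm{tr}(GB)$ for bounded operators $B$ on $\mathcal F$: 1. for every $\beta\ge0$, $\ \omega(e^{-\beta\mathcal N})=\mathrm{Det}\bigl(1+(e^{-\beta}-1)\gamma\bigr)$, where $\mathrm{Det}(1+T)=\sum_{k\ge0}\mathrm{tr}(\bigwedge^kT)$ is the Fredholm determinant; 2. with $k_0:=\dim\ker(\gamma-1)$, for every integer $k\ge k_0$, $$\omega(\mathcal P_k)\le\frac{(e\,\mathrm{tr}\,\gamma)^k}{k!}\,e^{-\mathrm{tr}\,\gamma};$$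 3. $\omega(\mathcal P_k)=0$ for every integer $0\le k<k_0$. -/

import Mathlib

open scoped InnerProductSpace ComplexOrder

namespace QuasiFree

universe u

section ExteriorPower

variable {H : Type u} [NormedAddCommGroup H] [InnerProductSpace ℂ H] {n : ℕ}

/-- For fixed `v`, the alternating map `w ↦ det (⟪vᵢ, wⱼ⟫)`. -/
noncomputable def gramAlt (v : Fin n → H) : H [⋀^Fin n]→ₗ[ℂ] ℂ :=
  (Matrix.detRowAlternating (n := Fin n) (R := ℂ)).compLinearMap
    (LinearMap.pi fun i => innerₛₗ ℂ (v i))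

theorem gramAlt_apply (v w : Fin n → H) :
    gramAlt v w = Matrix.det (Matrix.of fun i j => ⟪v i, w j⟫_ℂ) := by
  rw [← Matrix.det_transpose]
  rfl

/-- The linear functional `y ↦ ⟨v₁ ∧ ⋯ ∧ vₙ, y⟩` on `⋀ⁿ H`. -/
noncomputable def gramFun (v : Fin n → H) : ⋀[ℂ]^n H →ₗ[ℂ] ℂ :=
  exteriorPower.alternatingMapLinearEquiv (gramAlt v)

theorem gramFun_ιMulti (v w : Fin n → H) :
    gramFun v (exteriorPower.ιMulti ℂ n w) = Matrix.det (Matrix.of fun i j => ⟪v i, w j⟫_ℂ) := by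
  rw [gramFun, exteriorPower.alternatingMapLinearEquiv_apply_ιMulti, gramAlt_apply]

/-- For fixed `y`, the alternating map `v ↦ conj ⟪v₁ ∧ ⋯ ∧ vₙ, y⟫`. -/
noncomputable def gramConj (y : ⋀[ℂ]^n H) : H [⋀^Fin n]→ₗ[ℂ] ℂ where
  toFun v := starRingEnd ℂ (gramFun v y)
  map_update_add' {inst} v i a b := by
    have : inst = instDecidableEqFin n := Subsingleton.elim _ _
    subst this
    have h : gramFun (Function.update v i (a + b)) =
        gramFun (Function.update v i a) + gramFun (Function.update v i b) := by
      apply exteriorPower.linearMap_ext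
      ext w
      simp only [LinearMap.compAlternatingMap_apply, LinearMap.add_apply, gramFun_ιMulti]
      have e (c : H) : (Matrix.of fun k j => ⟪Function.update v i c k, w j⟫_ℂ) =
          (Matrix.of fun k j => ⟪v k, w j⟫_ℂ).updateRow i (fun j => ⟪c, w j⟫_ℂ) := by
        ext k j
        by_cases hk : k = i
        · subst hk; simp
        · simp [hk]
      rw [e, e, e, ← Matrix.det_updateRow_add]
      congr 2
      ext j
      simp
    simp [h]
  map_update_smul' {inst} v i c a := by
    have : inst = instDecidableEqFin n := Subsingleton.elim _ _
    subst this
    have h : gramFun (Function.update v i (c • a)) =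
        (starRingEnd ℂ c) • gramFun (Function.update v i a) := by
      apply exteriorPower.linearMap_ext
      ext w
      simp only [LinearMap.compAlternatingMap_apply, LinearMap.smul_apply, gramFun_ιMulti]
      have e (c : H) : (Matrix.of fun k j => ⟪Function.update v i c k, w j⟫_ℂ) =
          (Matrix.of fun k j => ⟪v k, w j⟫_ℂ).updateRow i (fun j => ⟪c, w j⟫_ℂ) := by
        ext k j
        by_cases hk : k = i
        · subst hk; simp
        · simp [hk]
      rw [e, e, smul_eq_mul, ← Matrix.det_updateRow_smul]
      congr 2
      ext j
      simp [mul_comm]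
    simp [h]
  map_eq_zero_of_eq' v i j hv hij := by
    have h : gramFun v = 0 := by
      apply exteriorPower.linearMap_ext
      ext w
      simp only [LinearMap.compAlternatingMap_apply, LinearMap.zero_apply, gramFun_ιMulti]
      refine Matrix.det_zero_of_row_eq hij ?_
      ext k
      simp [hv]
    simp [h]

/-- The sesquilinear form on `⋀ⁿ H` (linear in the second argument) with
`⟨v₁ ∧ ⋯ ∧ vₙ, w₁ ∧ ⋯ ∧ wₙ⟩ = det (⟪vᵢ, wⱼ⟫)`, see `form_ιMulti`. -/
noncomputable def form (x y : ⋀[ℂ]^n H) : ℂ :=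
  starRingEnd ℂ (exteriorPower.alternatingMapLinearEquiv (gramConj y) x)

theorem form_ιMulti_left (v : Fin n → H) (y : ⋀[ℂ]^n H) :
    form (exteriorPower.ιMulti ℂ n v) y = gramFun v y := by
  rw [form, exteriorPower.alternatingMapLinearEquiv_apply_ιMulti]
  exact Complex.conj_conj _

theorem form_ιMulti (v w : Fin n → H) :
    form (exteriorPower.ιMulti ℂ n v) (exteriorPower.ιMulti ℂ n w) =
      Matrix.det (Matrix.of fun i j => ⟪v i, w j⟫_ℂ) := by
  rw [form_ιMulti_left, gramFun_ιMulti]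

theorem form_add_left (x x' y : ⋀[ℂ]^n H) : form (x + x') y = form x y + form x' y := by
  simp [form]

theorem form_smul_left (c : ℂ) (x y : ⋀[ℂ]^n H) :
    form (c • x) y = starRingEnd ℂ c * form x y := by
  simp [form]

theorem ext_induction {p : ⋀[ℂ]^n H → Prop} (x : ⋀[ℂ]^n H)
    (h : ∀ v, p (exteriorPower.ιMulti ℂ n v)) (h0 : p 0)
    (hadd : ∀ x y, p x → p y → p (x + y)) (hsmul : ∀ (c : ℂ) x, p x → p (c • x)) : p x := by
  have hx : x ∈ Submodule.span ℂ (Set.range (exteriorPower.ιMulti ℂ n (M := H))) := by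
    rw [exteriorPower.ιMulti_span]; trivial
  induction hx using Submodule.span_induction with
  | mem x hx => obtain ⟨v, rfl⟩ := hx; exact h v
  | zero => exact h0
  | add x y _ _ hx hy => exact hadd x y hx hy
  | smul c x _ hx => exact hsmul c x hx

theorem form_zero_left (y : ⋀[ℂ]^n H) : form 0 y = 0 := by
  simp [form]

theorem form_add_right (x y y' : ⋀[ℂ]^n H) : form x (y + y') = form x y + form x y' := by
  induction x using ext_induction with
  | h v => simp [form_ιMulti_left]
  | h0 => simp [form_zero_left]
  | hadd x x' h h' => rw [form_add_left, form_add_left, form_add_left, h, h']; ring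
  | hsmul c x h => rw [form_smul_left, form_smul_left, form_smul_left, h]; ring

theorem form_smul_right (c : ℂ) (x y : ⋀[ℂ]^n H) : form x (c • y) = c * form x y := by
  induction x using ext_induction with
  | h v => simp [form_ιMulti_left]
  | h0 => simp [form_zero_left]
  | hadd x x' h h' => rw [form_add_left, form_add_left, h, h']; ring
  | hsmul d x h => rw [form_smul_left, form_smul_left, h]; ring

theorem form_zero_right (x : ⋀[ℂ]^n H) : form x 0 = 0 := by
  rw [← zero_smul ℂ (0 : ⋀[ℂ]^n H), form_smul_right, zero_mul]

theorem form_sum_left {κ : Type*} (s : Finset κ) (z : κ → ⋀[ℂ]^n H) (y : ⋀[ℂ]^n H) :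
    form (∑ k ∈ s, z k) y = ∑ k ∈ s, form (z k) y := by
  classical
  induction s using Finset.induction_on with
  | empty => simp [form_zero_left]
  | insert a s ha ih => rw [Finset.sum_insert ha, Finset.sum_insert ha, form_add_left, ih]

theorem form_conj_symm (x y : ⋀[ℂ]^n H) : starRingEnd ℂ (form y x) = form x y := by
  induction x using ext_induction with
  | h v =>
    induction y using ext_induction with
    | h w =>
      rw [form_ιMulti, form_ιMulti, RingHom.map_det, ← Matrix.det_transpose]
      congr 1
      ext i j
      simp
    | h0 => simp [form_zero_left, form_zero_right]
    | hadd x x' h h' => rw [form_add_left, form_add_right, map_add, h, h']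
    | hsmul c x h => rw [form_smul_left, form_smul_right, map_mul, h, Complex.conj_conj]
  | h0 => simp [form_zero_left, form_zero_right]
  | hadd x x' h h' => rw [form_add_left, form_add_right, map_add, h, h']
  | hsmul c x h => rw [form_smul_left, form_smul_right, map_mul, h]

/-- Exterior multiplication by `f`: `v₁ ∧ ⋯ ∧ vₙ ↦ f ∧ v₁ ∧ ⋯ ∧ vₙ`. -/
noncomputable def wedge (n : ℕ) : H →ₗ[ℂ] ⋀[ℂ]^n H →ₗ[ℂ] ⋀[ℂ]^(n + 1) H :=
  exteriorPower.alternatingMapLinearEquiv.toLinearMap ∘ₗ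
    (exteriorPower.ιMulti ℂ (n + 1) (M := H)).curryLeft

theorem wedge_ιMulti (f : H) (v : Fin n → H) :
    wedge n f (exteriorPower.ιMulti ℂ n v) = exteriorPower.ιMulti ℂ (n + 1) (Fin.cons f v) := by
  simp only [wedge, LinearMap.comp_apply, LinearEquiv.coe_coe,
    exteriorPower.alternatingMapLinearEquiv_apply_ιMulti]
  rfl

/-- Interior multiplication by `f`:
`v₀ ∧ ⋯ ∧ vₙ ↦ ∑ᵢ (-1)ⁱ ⟪f, vᵢ⟫ v₀ ∧ ⋯ ∧ v̂ᵢ ∧ ⋯ ∧ vₙ`. -/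
noncomputable def contract (n : ℕ) (f : H) : ⋀[ℂ]^(n + 1) H →ₗ[ℂ] ⋀[ℂ]^n H :=
  exteriorPower.alternatingMapLinearEquiv
    (AlternatingMap.alternatizeUncurryFin
      ((innerₛₗ ℂ f).smulRight (exteriorPower.ιMulti ℂ n (M := H))))

theorem contract_ιMulti (f : H) (v : Fin (n + 1) → H) :
    contract n f (exteriorPower.ιMulti ℂ (n + 1) v) =
      ∑ i : Fin (n + 1), ((-1) ^ (i : ℕ) * ⟪f, v i⟫_ℂ) •
        exteriorPower.ιMulti ℂ n (i.removeNth v) := by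
  rw [contract, exteriorPower.alternatingMapLinearEquiv_apply_ιMulti,
    AlternatingMap.alternatizeUncurryFin_apply]
  refine Finset.sum_congr rfl fun i _ => ?_
  rw [mul_smul]
  rcases Nat.even_or_odd (i : ℕ) with h | h <;> simp [h.neg_one_pow]

theorem form_wedge_left (f : H) (x : ⋀[ℂ]^n H) (y : ⋀[ℂ]^(n + 1) H) :
    form (wedge n f x) y = form x (contract n f y) := by
  induction x using ext_induction with
  | h v =>
    induction y using ext_induction with
    | h w =>
      rw [wedge_ιMulti, contract_ιMulti, form_ιMulti, Matrix.det_succ_row_zero,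
        form_ιMulti_left, map_sum]
      refine Finset.sum_congr rfl fun i _ => ?_
      rw [map_smul, gramFun_ιMulti]
      simp only [Matrix.of_apply, Fin.cons_zero, smul_eq_mul]
      congr 1
    | h0 => simp [form_zero_right]
    | hadd y y' h h' => rw [form_add_right, map_add, form_add_right, h, h']
    | hsmul c y h => rw [form_smul_right, map_smul, form_smul_right, h]
  | h0 => simp [form_zero_left]
  | hadd x x' h h' => rw [map_add, form_add_left, form_add_left, h, h']
  | hsmul c x h => rw [map_smul, form_smul_left, form_smul_left, h]

theorem contract_wedge_zero (f g : H) (x : ⋀[ℂ]^0 H) :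
    contract 0 f (wedge 0 g x) = ⟪f, g⟫_ℂ • x := by
  induction x using ext_induction with
  | h v =>
    rw [wedge_ιMulti, contract_ιMulti]
    simp
  | h0 => simp
  | hadd x x' h h' => rw [map_add, map_add, smul_add, h, h']
  | hsmul c x h => rw [map_smul, map_smul, h, smul_comm]

theorem contract_wedge_succ (f g : H) (x : ⋀[ℂ]^(n + 1) H) :
    contract (n + 1) f (wedge (n + 1) g x) = ⟪f, g⟫_ℂ • x - wedge n g (contract n f x) := by
  induction x using ext_induction with
  | h v =>
    rw [wedge_ιMulti, contract_ιMulti, contract_ιMulti, Fin.sum_univ_succ, sub_eq_add_neg, map_sum,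
      ← Finset.sum_neg_distrib]
    congr 1
    · simp
    · refine Finset.sum_congr rfl fun i _ => ?_
      rw [map_smul, wedge_ιMulti]
      refine Eq.trans ?_ (neg_smul _ _)
      congr 1
      · simp [pow_succ]
      · congr 1
        ext j
        refine Fin.cases ?_ (fun j => ?_) j
        · simp [Fin.removeNth]
        · simp [Fin.removeNth]
  | h0 => simp
  | hadd x x' h h' => simp only [map_add, smul_add, h, h']; abel
  | hsmul c x h => simp only [map_smul, h, smul_sub, smul_comm c]

theorem sum_form_contract {ι : Type*} [Fintype ι] (W : Submodule ℂ H)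
    (b : OrthonormalBasis ι ℂ W) (x y : ⋀[ℂ]^(n + 1) H)
    (hx : x ∈ Submodule.span ℂ
      (exteriorPower.ιMulti ℂ (n + 1) '' {v : Fin (n + 1) → H | ∀ i, v i ∈ W})) :
    ∑ k, form (contract n (b k : H) x) (contract n (b k : H) y) = ((n : ℂ) + 1) * form x y := by
  induction hx using Submodule.span_induction with
  | mem x hx =>
    obtain ⟨v, hv, rfl⟩ := hx
    have key (i : Fin (n + 1)) :
        ∑ k, form (((-1) ^ (i : ℕ) * ⟪(b k : H), v i⟫_ℂ) •
          exteriorPower.ιMulti ℂ n (i.removeNth v)) (contract n (b k : H) y) =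
        form (exteriorPower.ιMulti ℂ (n + 1) v) y := by
      have h1 : ∑ k, ⟪(b k : H), v i⟫_ℂ • (b k : H) = v i := by
        have := congrArg (Submodule.subtype W) (b.sum_repr' ⟨v i, hv i⟩)
        simpa using this
      have h2 : exteriorPower.ιMulti ℂ (n + 1) v =
          ∑ k, ((-1) ^ (i : ℕ) * ⟪(b k : H), v i⟫_ℂ) •
            wedge n (b k : H) (exteriorPower.ιMulti ℂ n (i.removeNth v)) := by
        simp_rw [mul_smul]
        rw [← Finset.smul_sum]
        have h3 : ∑ k, ⟪(b k : H), v i⟫_ℂ •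
            wedge n (b k : H) (exteriorPower.ιMulti ℂ n (i.removeNth v)) =
            wedge n (v i) (exteriorPower.ιMulti ℂ n (i.removeNth v)) := by
          conv_rhs => rw [← h1]
          rw [map_sum, LinearMap.sum_apply]
          refine Finset.sum_congr rfl fun k _ => ?_
          rw [map_smul, LinearMap.smul_apply]
        rw [h3, wedge_ιMulti]
        have := AlternatingMap.map_insertNth (exteriorPower.ιMulti ℂ (n + 1) (M := H)) i (v i)
          (i.removeNth v)
        rw [Fin.insertNth_self_removeNth] at this
        rw [this]
        rcases Nat.even_or_odd (i : ℕ) with h | h <;> simp [h.neg_one_pow] <;> rfl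
      rw [h2, form_sum_left]
      refine Finset.sum_congr rfl fun k _ => ?_
      rw [form_smul_left, form_smul_left, form_wedge_left]
    simp_rw [contract_ιMulti _ v, form_sum_left]
    rw [Finset.sum_comm]
    simp [key]
  | zero => simp [form_zero_left]
  | add x x' _ _ h h' =>
    simp only [map_add, form_add_left, Finset.sum_add_distrib, h, h', mul_add]
  | smul c x _ h =>
    simp only [map_smul, form_smul_left, ← Finset.mul_sum, h]
    ring

theorem exists_finiteDimensional_mem (x : ⋀[ℂ]^n H) :
    ∃ W : Submodule ℂ H, FiniteDimensional ℂ W ∧ x ∈ Submodule.span ℂ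
      (exteriorPower.ιMulti ℂ n '' {v : Fin n → H | ∀ i, v i ∈ W}) := by
  induction x using ext_induction with
  | h v =>
    exact ⟨Submodule.span ℂ (Set.range v), FiniteDimensional.span_of_finite ℂ (Set.finite_range v),
      Submodule.subset_span ⟨v, fun i => Submodule.subset_span ⟨i, rfl⟩, rfl⟩⟩
  | h0 => exact ⟨⊥, inferInstance, zero_mem _⟩
  | hadd x y hx hy =>
    obtain ⟨W, hW, hx⟩ := hx
    obtain ⟨W', hW', hy⟩ := hy
    have mono (V : Submodule ℂ H) (hV : V ≤ W ⊔ W') :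
        Submodule.span ℂ (exteriorPower.ιMulti ℂ n '' {v : Fin n → H | ∀ i, v i ∈ V}) ≤
        Submodule.span ℂ
          (exteriorPower.ιMulti ℂ n '' {v : Fin n → H | ∀ i, v i ∈ W ⊔ W'}) := by
      refine Submodule.span_mono (Set.image_mono ?_)
      intro v hv i
      exact hV (hv i)
    exact ⟨W ⊔ W', inferInstance, add_mem (mono W le_sup_left hx) (mono W' le_sup_right hy)⟩
  | hsmul c x hx =>
    obtain ⟨W, hW, hx⟩ := hx
    exact ⟨W, hW, Submodule.smul_mem _ _ hx⟩

theorem form_self_nonneg : ∀ {n : ℕ} (x : ⋀[ℂ]^n H), 0 ≤ (form x x).re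
  | 0, x => by
    have hx : x ∈ Submodule.span ℂ
        {exteriorPower.ιMulti ℂ 0 (M := H) (fun i => i.elim0)} := by
      induction x using ext_induction with
      | h v => rw [Subsingleton.elim v (fun i => i.elim0)]; exact Submodule.mem_span_singleton_self _
      | h0 => exact zero_mem _
      | hadd x y hx hy => exact add_mem hx hy
      | hsmul c x hx => exact Submodule.smul_mem _ _ hx
    obtain ⟨c, rfl⟩ := Submodule.mem_span_singleton.1 hx
    rw [form_smul_left, form_smul_right, form_ιMulti, Matrix.det_isEmpty, mul_one,
      ← Complex.normSq_eq_conj_mul_self, Complex.ofReal_re]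
    exact Complex.normSq_nonneg c
  | n + 1, x => by
    obtain ⟨W, hW, hx⟩ := exists_finiteDimensional_mem x
    have h := congrArg Complex.re (sum_form_contract W (stdOrthonormalBasis ℂ W) x x hx)
    rw [Complex.re_sum] at h
    have h1 : 0 ≤ (((n : ℂ) + 1) * form x x).re :=
      h ▸ Finset.sum_nonneg fun k _ => form_self_nonneg _
    have h2 : (((n : ℂ) + 1) * form x x).re = ((n : ℝ) + 1) * (form x x).re := by
      simp [Complex.mul_re]
    rw [h2] at h1
    exact nonneg_of_mul_nonneg_right h1 (by positivity)

theorem form_wedge_self_le (f : H) (x : ⋀[ℂ]^n H) :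
    (form (wedge n f x) (wedge n f x)).re ≤ ‖f‖ ^ 2 * (form x x).re := by
  have hf : (⟪f, f⟫_ℂ * form x x).re = ‖f‖ ^ 2 * (form x x).re := by
    rw [inner_self_eq_norm_sq_to_K]
    have : ((‖f‖ : ℂ)) ^ 2 = ((‖f‖ ^ 2 : ℝ) : ℂ) := by push_cast; rfl
    erw [this, Complex.re_ofReal_mul]
  rw [form_wedge_left]
  cases n with
  | zero =>
    rw [contract_wedge_zero, form_smul_right, hf]
  | succ n =>
    rw [contract_wedge_succ, sub_eq_add_neg, form_add_right, form_smul_right, Complex.add_re, hf,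
      ← neg_one_smul ℂ, form_smul_right,
      ← form_conj_symm x (wedge n f _), form_wedge_left]
    have := form_self_nonneg (contract n f x)
    simp
    exact this

end ExteriorPower
section FockSpace

variable (H : Type u) [NormedAddCommGroup H] [InnerProductSpace ℂ H]

/-- The pre-inner product on the algebraic exterior power `⋀ⁿ H`. -/
noncomputable abbrev preCore (n : ℕ) : PreInnerProductSpace.Core ℂ (⋀[ℂ]^n H) where
  inner := form
  conj_inner_symm := form_conj_symm
  re_inner_nonneg := form_self_nonneg
  add_left := form_add_left
  smul_left x y c := form_smul_left c x y

noncomputable instance instSeminormed (n : ℕ) : SeminormedAddCommGroup (⋀[ℂ]^n H) :=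
  InnerProductSpace.Core.toSeminormedAddCommGroup (c := preCore H n)

noncomputable instance instInner (n : ℕ) : InnerProductSpace ℂ (⋀[ℂ]^n H) :=
  InnerProductSpace.ofCore (preCore H n)

/-- The `n`-particle space: the Hilbert space completion of `⋀ⁿ H`. -/
def NParticle (n : ℕ) : Type u := UniformSpace.Completion (⋀[ℂ]^n H)

noncomputable instance (n : ℕ) : NormedAddCommGroup (NParticle H n) :=
  inferInstanceAs (NormedAddCommGroup (UniformSpace.Completion (⋀[ℂ]^n H)))

noncomputable instance (n : ℕ) : InnerProductSpace ℂ (NParticle H n) :=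
  inferInstanceAs (InnerProductSpace ℂ (UniformSpace.Completion (⋀[ℂ]^n H)))

instance (n : ℕ) : CompleteSpace (NParticle H n) :=
  inferInstanceAs (CompleteSpace (UniformSpace.Completion (⋀[ℂ]^n H)))

/-- The fermionic Fock space: the Hilbert space direct sum of the `n`-particle spaces. -/
abbrev Fock : Type u := lp (fun n : ℕ => NParticle H n) 2

variable {H}

theorem norm_wedge_le {n : ℕ} (f : H) (x : ⋀[ℂ]^n H) : ‖wedge n f x‖ ≤ ‖f‖ * ‖x‖ := by
  refine abs_le_of_sq_le_sq' ?_ (by positivity) |>.2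
  rw [mul_pow, @norm_sq_eq_re_inner ℂ, @norm_sq_eq_re_inner ℂ _ _ _ _ x]
  exact form_wedge_self_le f x

/-- The creation operator from the `n`-particle space to the `(n+1)`-particle space,
the continuous extension of `x ↦ f ∧ x`. -/
noncomputable def creationSector (n : ℕ) (f : H) : NParticle H n →L[ℂ] NParticle H (n + 1) :=
  ContinuousLinearMap.completion ((wedge n f).mkContinuous ‖f‖ (norm_wedge_le f))

theorem norm_creationSector_le (n : ℕ) (f : H) (x : NParticle H n) :
    ‖creationSector n f x‖ ≤ ‖f‖ * ‖x‖ := by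
  induction x using UniformSpace.Completion.induction_on with
  | hp =>
    exact isClosed_le (creationSector n f).continuous.norm
      (continuous_const.mul (continuous_norm (E := NParticle H n)))
  | ih x =>
    have h : creationSector n f (x : UniformSpace.Completion (⋀[ℂ]^n H)) =
        ((wedge n f x : ⋀[ℂ]^(n + 1) H) : UniformSpace.Completion (⋀[ℂ]^(n + 1) H)) :=
      ContinuousLinearMap.completion_apply_coe ((wedge n f).mkContinuous ‖f‖ (norm_wedge_le f)) x
    rw [h]
    exact (UniformSpace.Completion.norm_coe (wedge n f x)).trans_le ((norm_wedge_le f x).trans_eq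
      (congrArg (‖f‖ * ·) (UniformSpace.Completion.norm_coe x).symm))

/-- The components of `a*(f) ψ`. -/
noncomputable def creationComponent (f : H) (ψ : ∀ n, NParticle H n) : ∀ n, NParticle H n
  | 0 => 0
  | n + 1 => creationSector n f (ψ n)

theorem fock_summable (ψ : Fock H) : Summable fun n => ‖ψ n‖ ^ 2 := by
  simpa using (lp.memℓp ψ).summable (by norm_num)

theorem fock_norm_sq (ψ : Fock H) : ‖ψ‖ ^ 2 = ∑' n, ‖ψ n‖ ^ 2 := by
  simpa using lp.norm_rpow_eq_tsum (p := 2) (by norm_num) ψ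

theorem fock_mem {φ : ∀ n, NParticle H n} (h : Summable fun n => ‖φ n‖ ^ 2) : Memℓp φ 2 :=
  memℓp_gen (by simpa using h)

theorem creationComponent_summable (f : H) (ψ : Fock H) :
    Summable fun n => ‖creationComponent f ψ n‖ ^ 2 := by
  rw [← summable_nat_add_iff 1]
  refine Summable.of_nonneg_of_le (fun n => by positivity) (fun n => ?_)
    ((fock_summable ψ).mul_left (‖f‖ ^ 2))
  rw [← mul_pow]
  gcongr
  exact norm_creationSector_le n f (ψ n)

theorem creationComponent_add (f : H) (ψ φ : ∀ n, NParticle H n) :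
    creationComponent f (ψ + φ) = creationComponent f ψ + creationComponent f φ := by
  funext n
  cases n with
  | zero => exact (add_zero (0 : NParticle H 0)).symm
  | succ n => exact map_add (creationSector n f) (ψ n) (φ n)

theorem creationComponent_smul (f : H) (c : ℂ) (ψ : ∀ n, NParticle H n) :
    creationComponent f (c • ψ) = c • creationComponent f ψ := by
  funext n
  cases n with
  | zero => exact (smul_zero c).symm
  | succ n => exact map_smul (creationSector n f) c (ψ n)

theorem creationComponent_tsum_le (f : H) (ψ : Fock H) :
    ∑' n, ‖creationComponent f ψ n‖ ^ 2 ≤ ‖f‖ ^ 2 * ∑' n, ‖ψ n‖ ^ 2 := by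
  rw [← tsum_mul_left, (creationComponent_summable f ψ).tsum_eq_zero_add]
  have h0 : ‖creationComponent f ψ 0‖ ^ 2 = 0 := by
    change ‖(0 : NParticle H 0)‖ ^ 2 = 0
    simp
  rw [h0, zero_add]
  have h1 : Summable fun n => ‖creationComponent f ψ (n + 1)‖ ^ 2 :=
    (summable_nat_add_iff (f := fun n => ‖creationComponent f ψ n‖ ^ 2) 1).2
      (creationComponent_summable f ψ)
  have h2 : ∀ n, ‖creationComponent f ψ (n + 1)‖ ^ 2 ≤ ‖f‖ ^ 2 * ‖ψ n‖ ^ 2 := fun n => by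
    rw [← mul_pow]
    exact pow_le_pow_left₀ (norm_nonneg _) (norm_creationSector_le n f (ψ n)) 2
  exact Summable.tsum_le_tsum h2 h1 ((fock_summable ψ).mul_left (‖f‖ ^ 2))

/-- The creation operator as a linear map. -/
noncomputable def creationLinear (f : H) : Fock H →ₗ[ℂ] Fock H where
  toFun ψ := ⟨creationComponent f ψ, fock_mem (creationComponent_summable f ψ)⟩
  map_add' ψ φ := Subtype.ext (creationComponent_add f ψ φ)
  map_smul' c ψ := Subtype.ext (creationComponent_smul f c ψ)

theorem norm_creationLinear_le (f : H) (ψ : Fock H) : ‖creationLinear f ψ‖ ≤ ‖f‖ * ‖ψ‖ := by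
  have h : ‖creationLinear f ψ‖ ^ 2 ≤ (‖f‖ * ‖ψ‖) ^ 2 := by
    rw [mul_pow, fock_norm_sq, fock_norm_sq]
    exact creationComponent_tsum_le f ψ
  exact (sq_le_sq₀ (norm_nonneg _) (mul_nonneg (norm_nonneg f) (norm_nonneg ψ))).1 h

/-- The creation operator `a*(f)` on Fock space. -/
noncomputable def creation (f : H) : Fock H →L[ℂ] Fock H :=
  (creationLinear f).mkContinuous ‖f‖ (norm_creationLinear_le f)

/-- The annihilation operator `a(f)`, the adjoint of `a*(f)`. -/
noncomputable def annihilation (f : H) : Fock H →L[ℂ] Fock H :=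
  ContinuousLinearMap.adjoint (creation f)

theorem numberFunction_summable (c : ℕ → ℂ) (hc : ∀ n, ‖c n‖ ≤ 1) (ψ : Fock H) :
    Summable fun n => ‖c n • ψ n‖ ^ 2 := by
  refine Summable.of_nonneg_of_le (fun n => by positivity) (fun n => ?_) (fock_summable ψ)
  rw [norm_smul]
  gcongr
  exact mul_le_of_le_one_left (norm_nonneg _) (hc n)

/-- The linear map `⨁ₙ c(n) · Id` on Fock space. -/
noncomputable def numberFunctionLinear (c : ℕ → ℂ) (hc : ∀ n, ‖c n‖ ≤ 1) :
    Fock H →ₗ[ℂ] Fock H where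
  toFun ψ := ⟨fun n => c n • ψ n, fock_mem (numberFunction_summable c hc ψ)⟩
  map_add' ψ φ := Subtype.ext (funext fun n => smul_add (c n) (ψ n) (φ n))
  map_smul' d ψ := Subtype.ext (funext fun n => smul_comm (c n) d (ψ n))

theorem norm_numberFunctionLinear_le (c : ℕ → ℂ) (hc : ∀ n, ‖c n‖ ≤ 1) (ψ : Fock H) :
    ‖numberFunctionLinear c hc ψ‖ ≤ 1 * ‖ψ‖ := by
  have h : ‖numberFunctionLinear c hc ψ‖ ^ 2 ≤ ‖ψ‖ ^ 2 := by
    rw [fock_norm_sq, fock_norm_sq]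
    refine Summable.tsum_le_tsum (fun n => ?_) (numberFunction_summable c hc ψ) (fock_summable ψ)
    change ‖c n • ψ n‖ ^ 2 ≤ _
    rw [norm_smul]
    gcongr
    exact mul_le_of_le_one_left (norm_nonneg _) (hc n)
  rw [one_mul]
  exact (sq_le_sq₀ (norm_nonneg _) (norm_nonneg ψ)).1 h

/-- The bounded function `c(N)` of the particle number operator `N = ⨁ₙ n · Id`, that is, the
operator `⨁ₙ c(n) · Id` (for `|c| ≤ 1`). -/
noncomputable def numberFunction (c : ℕ → ℂ) (hc : ∀ n, ‖c n‖ ≤ 1) : Fock H →L[ℂ] Fock H :=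
  (numberFunctionLinear c hc).mkContinuous 1 (norm_numberFunctionLinear_le c hc)

/-- The operator `e^{-βN}`, `β ≥ 0`. -/
noncomputable def expNegNumber (β : NNReal) : Fock H →L[ℂ] Fock H :=
  numberFunction (fun n => ((Real.exp (-(β * n)) : ℝ) : ℂ)) fun n => by
    rw [Complex.norm_real, Real.norm_eq_abs, abs_of_pos (Real.exp_pos _), Real.exp_le_one_iff]
    have : (0 : ℝ) ≤ β * n := by positivity
    linarith

/-- The orthogonal projection `P_k = 1_{N = k}` of Fock space onto the `k`-particle space. -/
noncomputable def sectorProjection (k : ℕ) : Fock H →L[ℂ] Fock H :=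
  numberFunction (fun n => if n = k then 1 else 0) fun n => by split_ifs <;> simp

end FockSpace

section Trace

variable {E : Type u} [NormedAddCommGroup E] [InnerProductSpace ℂ E] [CompleteSpace E]

variable (E) in
/-- The index set of a fixed orthonormal (Hilbert) basis of `E`. -/
def basisIndex : Set E := (exists_hilbertBasis ℂ E).choose

variable (E) in
/-- A fixed orthonormal (Hilbert) basis of `E`, used to compute traces. -/
noncomputable def onb : HilbertBasis (basisIndex E) ℂ E :=
  (exists_hilbertBasis ℂ E).choose_spec.choose

/-- `T` is trace class: `tr |T| < ∞`, where `|T| = √(T* T)`. -/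
def IsTraceClass (T : E →L[ℂ] E) : Prop :=
  Summable fun i => (⟪onb E i, (CFC.abs T) (onb E i)⟫_ℂ).re

/-- The trace `tr T = ∑ᵢ ⟪eᵢ, T eᵢ⟫` of a trace class operator (for such an operator the series is
absolutely convergent, with a sum independent of the orthonormal basis). -/
noncomputable def trace (T : E →L[ℂ] E) : ℂ :=
  ∑' i, ⟪onb E i, T (onb E i)⟫_ℂ

open Classical in
/-- `tr (⋀ᵏ T) = ∑_{|S| = k} ⟪e_S, (⋀ᵏ T) e_S⟫`, where `e_S` is the exterior product of
the basis vectors with index in `S`, so that the summand is a principal minor of the matrix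
of `T`. -/
noncomputable def traceExteriorPower (k : ℕ) (T : E →L[ℂ] E) : ℂ :=
  ∑' S : {S : Finset (basisIndex E) // S.card = k},
    Matrix.det (Matrix.of fun i j : S.1 => ⟪onb E i.1, T (onb E j.1)⟫_ℂ)

/-- The Fredholm determinant `Det (1 + T) = ∑ₖ tr (⋀ᵏ T)` of a trace class perturbation of the
identity, as a function of `T`. -/
noncomputable def fredholmDet (T : E →L[ℂ] E) : ℂ :=
  ∑' k, traceExteriorPower k T

end Trace

section States

variable (H : Type u) [NormedAddCommGroup H] [InnerProductSpace ℂ H]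

/-- The CAR algebra: the unital C*-subalgebra of the bounded operators on Fock space generated
by the creation operators (hence also by their adjoints, the annihilation operators). -/
noncomputable def CAR : StarSubalgebra ℂ (Fock H →L[ℂ] Fock H) :=
  (StarAlgebra.adjoin ℂ (Set.range (creation (H := H)))).topologicalClosure

variable {H}

/-- `a*(f)` as an element of the CAR algebra. -/
noncomputable def aStar (f : H) : CAR H :=
  ⟨creation f, StarSubalgebra.le_topologicalClosure _
    (StarAlgebra.subset_adjoin ℂ _ ⟨f, rfl⟩)⟩

/-- `a(f)` as an element of the CAR algebra. -/
noncomputable def aOp (f : H) : CAR H :=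
  ⟨annihilation f, star_mem (aStar f).2⟩

/-- A state on the CAR algebra: a non-negative, normalized linear functional. -/
structure IsState (ω : CAR H →ₗ[ℂ] ℂ) : Prop where
  nonneg : ∀ A : CAR H, 0 ≤ ω (star A * A)
  map_one : ω 1 = 1

/-- `π` belongs to the set of permutations of `{0, …, 2p-1}` (zero-based) with
`π(0) < π(2) < ⋯ < π(2p-2)` and `π(2j) < π(2j+1)` for all `j`. -/
def IsPairing {p : ℕ} (π : Equiv.Perm (Fin (2 * p))) : Prop :=
  (∀ i j : Fin p, i < j → π ⟨2 * i, by omega⟩ < π ⟨2 * j, by omega⟩) ∧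
    ∀ j : Fin p, π ⟨2 * j, by omega⟩ < π ⟨2 * j + 1, by omega⟩

/-- `e` is a creation or an annihilation operator. -/
def IsFieldOperator (e : CAR H) : Prop :=
  (∃ f, e = aStar f) ∨ ∃ f, e = aOp f

open Classical in
/-- Quasi-free states: odd products of creation and annihilation operators have vanishing
expectation, and even products satisfy the Wick formula. -/
structure IsQuasiFree (ω : CAR H →ₗ[ℂ] ℂ) : Prop extends IsState ω where
  odd : ∀ (p : ℕ) (e : Fin (2 * p + 1) → CAR H), (∀ i, IsFieldOperator (e i)) →
    ω (List.ofFn e).prod = 0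
  wick : ∀ (p : ℕ) (e : Fin (2 * p) → CAR H), (∀ i, IsFieldOperator (e i)) →
    ω (List.ofFn e).prod = ∑ π : Equiv.Perm (Fin (2 * p)) with IsPairing π,
      ((Equiv.Perm.sign π : ℤ) : ℂ) *
        ∏ j : Fin p, ω (e (π ⟨2 * j, by omega⟩) * e (π ⟨2 * j + 1, by omega⟩))

/-- `γ` is the one-particle density matrix of `ω`: `⟪g, γ f⟫ = ω(a*(f) a(g))`. -/
def IsOnePDM (ω : CAR H →ₗ[ℂ] ℂ) (γ : H →L[ℂ] H) : Prop :=
  ∀ f g : H, ⟪g, γ f⟫_ℂ = ω (aStar f * aOp g)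

/-- `α : K → H` is the pairing matrix of `ω` (relative to the antilinear isometry `J : H → K`):
`⟪α J f, g⟫ = ω(a*(f) a*(g))`. -/
def IsPairingMatrix {K : Type*} [NormedAddCommGroup K] [InnerProductSpace ℂ K]
    (J : H →ₛₗᵢ[starRingEnd ℂ] K) (ω : CAR H →ₗ[ℂ] ℂ) (α : K →L[ℂ] H) : Prop :=
  ∀ f g : H, ⟪α (J f), g⟫_ℂ = ω (aStar f * aStar g)

/-- `G` is a density matrix of `ω`: a non-negative operator on Fock space with trace one such that
`ω(A) = tr(G A)` for all `A` in the CAR algebra. The value `ω(B)` of the normal state `ω`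
at a bounded operator `B` on Fock space is then `tr(G B)`. -/
structure IsDensityMatrix (ω : CAR H →ₗ[ℂ] ℂ) (G : Fock H →L[ℂ] Fock H) : Prop where
  nonneg : G.IsPositive
  traceClass : IsTraceClass G
  trace_eq_one : trace G = 1
  apply_eq : ∀ A : CAR H, ω A = trace (G * (A : Fock H →L[ℂ] Fock H))

end States

end QuasiFree

open Filter Topology

namespace QuasiFree

universe u

/-! Since `γ` is non-negative and trace class, it has an orthonormal eigenbasis `b i` with summable
eigenvalues `lam i`, and the anticommutation relations force `lam i ≤ 1`. The vectors `occupation b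
S`, with `S` a finite set of modes, form an orthonormal basis of Fock space. In it the state is a
product measure: mode `i` is occupied with probability `lam i`, independently of the others. The
candidate density matrix is therefore diagonal, with entries `weight lam S = ∏_{i ∈ S} lam i · ∏_{i
∉ S} (1 - lam i)`. This form also covers eigenvalues 0 and 1, where a Gibbs exponential would
degenerate.

It represents `ω` because words in the field operators of the modes span a dense subspace of the CAR
algebra and both functionals are continuous. Modulo shorter words, a word can be permuted up to
sign. Thus (`apply_word_eq_zero`) only two kinds of words matter: those with a nonzero charge in
some mode, where both functionals vanish, and products of number operators of distinct modes, where
both give `∏ lam i`; on the side of `ω` this is Wick's formula with one surviving pairing.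

For an arbitrary density matrix `G`, the same number operators give the sums of its diagonal over
all supersets of a finite set. Inclusion-exclusion (`eq_zero_of_hasSum_superset`) recovers the
diagonal, which must be `weight lam`. Functions of the particle number are diagonal, so `tr (G c(N))
= ∑ c(|S|) weight lam S`.

The three claims now concern independent Bernoulli variables. The generating function `∑ z^|S|
weight lam S = ∏ (1 + (z - 1) lam i)` at `z = e^{-β}` is the Fredholm determinant, by Cauchy–Binet
(`hasSum_det`). Bounding it by `exp ((z - 1) tr γ)` and optimizing over `z` gives the Chernoff
bound. Finally, a set with fewer than `k₀` elements misses a mode with eigenvalue 1 and has weight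
0. -/

theorem hasSum_congr {M κ : Type*} [AddCommMonoid M] [TopologicalSpace M] {f g : κ → M} {a : M}
    (h : ∀ i, f i = g i) : HasSum f a ↔ HasSum g a := by
  rw [funext h]

/-! ### Non-negative trace class operators: eigenbases and basis independence of the trace -/

section TraceClass

variable {E : Type u} [NormedAddCommGroup E] [InnerProductSpace ℂ E]

theorem inner_mul_inner_swap (x y : E) : ⟪x, y⟫_ℂ * ⟪y, x⟫_ℂ = ((‖⟪y, x⟫_ℂ‖ ^ 2 : ℝ) : ℂ) := by
  rw [← inner_conj_symm x y, mul_comm, Complex.mul_conj, Complex.normSq_eq_norm_sq]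

theorem re_inner_sq_eq [CompleteSpace E] {R : E →L[ℂ] E} (hR : IsSelfAdjoint R) (x : E) :
    (⟪x, (R * R) x⟫_ℂ).re = ‖R x‖ ^ 2 := by
  have := hR.isSymmetric x (R x)
  simp only [ContinuousLinearMap.coe_coe] at this
  rw [mul_apply_eq_comp, ← this, @norm_sq_eq_re_inner ℂ]
  rfl

theorem hasSum_norm_sq_inner {ι : Type*} (e : HilbertBasis ι ℂ E) (x : E) :
    HasSum (fun i => ‖⟪e i, x⟫_ℂ‖ ^ 2) (‖x‖ ^ 2) := by
  have h := e.hasSum_inner_mul_inner x x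
  rw [inner_self_eq_norm_sq_to_K] at h
  rw [← Complex.hasSum_ofReal]
  simpa only [inner_mul_inner_swap, RCLike.ofReal_eq_complex_ofReal, ← Complex.ofReal_pow] using h

/-- The remainder has the coefficients `⟪R eᵢ, x⟫` for `i ∉ F` and 0 for `i ∈ F`; Parseval and
Cauchy–Schwarz give the bound. It controls the operator norm of `R` minus a finite rank truncation.
-/
theorem norm_sq_sub_sum_le {ι : Type*} [CompleteSpace E] (e : HilbertBasis ι ℂ E) {R : E →L[ℂ] E}
    (hR : IsSelfAdjoint R) (hs : Summable fun i => ‖R (e i)‖ ^ 2) (F : Finset ι) (x : E) :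
    ‖R x - ∑ i ∈ F, ⟪R (e i), x⟫_ℂ • e i‖ ^ 2 ≤
      (∑' i : {i // i ∉ F}, ‖R (e i)‖ ^ 2) * ‖x‖ ^ 2 := by
  classical
  set y := R x - ∑ i ∈ F, ⟪R (e i), x⟫_ℂ • e i with hy
  have hsym (i : ι) : ⟪e i, R x⟫_ℂ = ⟪R (e i), x⟫_ℂ :=
    (hR.isSymmetric (e i) x).symm
  have hin (i : ι) : ⟪e i, y⟫_ℂ = if i ∈ F then 0 else ⟪R (e i), x⟫_ℂ := by
    rw [hy, inner_sub_right, inner_sum, hsym]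
    simp only [inner_smul_right, orthonormal_iff_ite.1 e.orthonormal, mul_ite, mul_one, mul_zero,
      Finset.sum_ite_eq]
    split_ifs <;> simp
  have h1 := hasSum_norm_sq_inner e y
  have h2 : HasSum (fun i : {i // i ∉ F} => ‖⟪R (e i), x⟫_ℂ‖ ^ 2) (‖y‖ ^ 2) := by
    have : Function.support (fun i => ‖⟪e i, y⟫_ℂ‖ ^ 2) ⊆ {i | i ∉ F} := by
      intro i hi
      by_contra h
      simp only [Set.mem_ofPred_eq, not_not] at h
      simp [hin, h] at hi
    rw [← hasSum_subtype_iff_of_support_subset this] at h1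
    refine (hasSum_congr fun i => ?_).mp h1
    have hi : (i : ι) ∉ F := i.2
    simp [hin, hi]
  rw [← h2.tsum_eq, ← tsum_mul_right]
  refine Summable.tsum_le_tsum (fun i => ?_) h2.summable ((hs.subtype _).mul_right _)
  rw [← mul_pow]
  gcongr
  exact norm_inner_le_norm _ _

/-- Hilbert–Schmidt operators are norm limits of finite rank operators. -/
theorem isCompactOperator_of_summable_norm_sq {ι : Type*} [CompleteSpace E]
    (e : HilbertBasis ι ℂ E) {R : E →L[ℂ] E} (hR : IsSelfAdjoint R)
    (hs : Summable fun i => ‖R (e i)‖ ^ 2) : IsCompactOperator R := by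
  let A (F : Finset ι) : E →L[ℂ] E :=
    ∑ i ∈ F, InnerProductSpace.rankOne ℂ (e i) (R (e i))
  have hA (F : Finset ι) (x : E) : A F x = ∑ i ∈ F, ⟪R (e i), x⟫_ℂ • e i := by
    simp [A]
  have hlim : Tendsto A atTop (𝓝 R) := by
    rw [tendsto_iff_norm_sub_tendsto_zero]
    have h0 := tendsto_tsum_compl_atTop_zero (fun i => ‖R (e i)‖ ^ 2)
    have h1 : Tendsto (fun F : Finset ι => √(∑' i : {i // i ∉ F}, ‖R (e i)‖ ^ 2)) atTop (𝓝 0) := by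
      simpa using h0.sqrt
    refine squeeze_zero (fun _ => norm_nonneg _) (fun F => ?_) h1
    rw [norm_sub_rev]
    refine ContinuousLinearMap.opNorm_le_bound _ (Real.sqrt_nonneg _) fun x => ?_
    rw [sub_apply, hA]
    refine abs_le_of_sq_le_sq' ?_ (by positivity) |>.2
    rw [mul_pow, Real.sq_sqrt (tsum_nonneg fun i => by positivity)]
    exact norm_sq_sub_sum_le e hR hs F x
  refine isCompactOperator_of_tendsto hlim (Eventually.of_forall fun F => ?_)
  refine Submodule.sum_mem (compactOperator (RingHom.id ℂ) E E) fun i _ => ?_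
  change IsCompactOperator _
  rw [InnerProductSpace.rankOne_def']
  have h : IsCompactOperator (innerSL ℂ (R (e i))) :=
    isCompactOperator_of_locallyCompactSpace_dom _
  exact h.clm_comp (ContinuousLinearMap.toSpanSingleton ℂ (e i))

/-- With `R = √T` one has `⟪e, T e⟫ = ‖R e‖²`, so `R` is Hilbert–Schmidt and `T = R²` is compact. -/
theorem isCompactOperator_of_summable_inner {ι : Type*} [CompleteSpace E]
    (e : HilbertBasis ι ℂ E) {T : E →L[ℂ] E} (hT : T.IsPositive)
    (hs : Summable fun i => (⟪e i, T (e i)⟫_ℂ).re) : IsCompactOperator T := by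
  have hT0 : 0 ≤ T := (ContinuousLinearMap.nonneg_iff_isPositive T).2 hT
  set R := CFC.sqrt T with hRdef
  have hR : IsSelfAdjoint R := IsSelfAdjoint.of_nonneg (CFC.sqrt_nonneg T)
  have hRR : R * R = T := CFC.sqrt_mul_sqrt_self T hT0
  have hRs : Summable fun i => ‖R (e i)‖ ^ 2 := by
    refine hs.congr fun i => ?_
    rw [← hRR, re_inner_sq_eq hR]
  rw [← hRR]
  exact (isCompactOperator_of_summable_norm_sq e hR hRs).comp_clm R

/-- A compact symmetric operator has a Hilbert basis of eigenvectors. -/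
theorem exists_hilbertBasis_eigenvectors [CompleteSpace E] {T : E →L[ℂ] E}
    (hT : IsCompactOperator T) (hT' : (T : E →ₗ[ℂ] E).IsSymmetric) :
    ∃ (ι : Type u) (v : HilbertBasis ι ℂ E) (t : ι → ℂ), ∀ j, T (v j) = t j • v j := by
  let V : ℂ → Submodule ℂ E := fun μ => Module.End.eigenspace (T : Module.End ℂ E) μ
  have hcl (μ : ℂ) : IsClosed (V μ : Set E) := by
    have : (V μ : Set E) = {x | T x = μ • x} := by
      ext x
      simp [V]
    rw [this]
    exact isClosed_eq T.continuous (continuous_const_smul μ)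
  have (μ : ℂ) : CompleteSpace (V μ) := (hcl μ).completeSpace_coe
  choose w b hb using fun μ => exists_hilbertBasis ℂ (V μ)
  have hon : Orthonormal ℂ fun a : Σ μ, w μ => ((b a.1 a.2 : V a.1) : E) :=
    (hT'.orthogonalFamily_eigenspaces).orthonormal_sigma_orthonormal
    fun μ => (b μ).orthonormal
  -- A vector orthogonal to the chosen bases of all eigenspaces is orthogonal to each eigenspace, by
  -- expanding in its basis; the spectral theorem for compact symmetric operators then forces it to
  -- be 0.
  have hsp : (Submodule.span ℂ (Set.range fun a : Σ μ, w μ => ((b a.1 a.2 : V a.1) : E)))ᗮ = ⊥ := by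
    rw [eq_bot_iff, ← T.orthogonalComplement_iSup_eigenspaces_eq_bot hT hT']
    intro x hx
    rw [Submodule.mem_orthogonal] at hx ⊢
    intro u hu
    rw [Submodule.iSup_eq_span] at hu
    induction hu using Submodule.span_induction with
    | zero => simp
    | add y z _ _ hy hz => rw [inner_add_left, hy, hz, add_zero]
    | smul c y _ hy => rw [inner_smul_left, hy, mul_zero]
    | mem y hy =>
      obtain ⟨μ, hy⟩ := Set.mem_iUnion.1 hy
      have h1 := ((b μ).hasSum_repr ⟨y, hy⟩).mapL (V μ).subtypeL
      have h2 := h1.mapL (innerSL ℂ x)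
      have h3 : ⟪x, y⟫_ℂ = 0 := by
        refine h2.unique ?_
        convert hasSum_zero with i
        have := hx _ (Submodule.subset_span ⟨⟨μ, i⟩, rfl⟩)
        simp only [map_smul, Submodule.subtypeL_apply, innerSL_apply_apply]
        rw [← inner_conj_symm, this]
        simp
      rw [← inner_conj_symm, h3, map_zero]
  refine ⟨Σ μ, w μ, HilbertBasis.mkOfOrthogonalEqBot hon hsp, fun a => a.1, fun a => ?_⟩
  rw [HilbertBasis.coe_mkOfOrthogonalEqBot]
  exact Module.End.mem_eigenspace_iff.1 (b a.1 a.2).2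

/-- The double series `tⱼ ⟪eᵢ, vⱼ⟫ ⟪vⱼ, B eᵢ⟫` is summed in both orders: over `i` first it gives the
eigenvalue expression, over `j` first the diagonal elements in the basis `e`. -/
theorem hasSum_trace_of_eigenvectors {ι κ : Type*} [CompleteSpace E] (v : HilbertBasis κ ℂ E)
    {t : κ → ℝ} (ht : ∀ j, 0 ≤ t j) (hts : Summable t) {T : E →L[ℂ] E} (hT : T.IsPositive)
    (hv : ∀ j, T (v j) = (t j : ℂ) • v j) (e : HilbertBasis ι ℂ E) (B : E →L[ℂ] E) :
    HasSum (fun i => ⟪e i, T (B (e i))⟫_ℂ) (∑' j, (t j : ℂ) * ⟪v j, B (v j)⟫_ℂ) := by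
  let f : κ × ι → ℂ := fun p => t p.1 * (⟪e p.2, v p.1⟫_ℂ * ⟪v p.1, B (e p.2)⟫_ℂ)
  have hadj (j : κ) (i : ι) : ⟪v j, B (e i)⟫_ℂ = ⟪ContinuousLinearMap.adjoint B (v j), e i⟫_ℂ :=
    (ContinuousLinearMap.adjoint_inner_left _ _ _).symm
  have hrow (j : κ) : HasSum (fun i => f (j, i)) (t j * ⟪v j, B (v j)⟫_ℂ) := by
    have := (e.hasSum_inner_mul_inner (ContinuousLinearMap.adjoint B (v j)) (v j)).mul_left
      (t j : ℂ)
    rw [ContinuousLinearMap.adjoint_inner_left] at this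
    refine (hasSum_congr fun i => ?_).mp this
    simp only [f, hadj]
    ring
  have hrown (j : κ) : HasSum (fun i => t j * ((‖⟪e i, v j⟫_ℂ‖ ^ 2 +
      ‖⟪e i, ContinuousLinearMap.adjoint B (v j)⟫_ℂ‖ ^ 2) / 2))
      (t j * ((1 + ‖ContinuousLinearMap.adjoint B (v j)‖ ^ 2) / 2)) := by
    have h1 := hasSum_norm_sq_inner e (v j)
    rw [v.orthonormal.1 j, one_pow] at h1
    exact ((h1.add (hasSum_norm_sq_inner e _)).div_const 2).mul_left _
  have hsum : Summable f := by
    -- Majorant from `|xy| ≤ (x² + y²) / 2`; by Parseval its rows sum to at most `tⱼ (1 + ‖B*‖²) /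
    -- 2`.
    have hg : Summable fun p : κ × ι => t p.1 * ((‖⟪e p.2, v p.1⟫_ℂ‖ ^ 2 +
      ‖⟪e p.2, ContinuousLinearMap.adjoint B (v p.1)⟫_ℂ‖ ^ 2) / 2) := by
      refine (summable_prod_of_nonneg fun p => ?_).2 ⟨fun j => (hrown j).summable, ?_⟩
      · have := ht p.1
        positivity
      · simp_rw [fun j => (hrown j).tsum_eq]
        refine Summable.of_nonneg_of_le (fun j => by have := ht j; positivity) (fun j => ?_)
          (hts.mul_right ((1 + ‖ContinuousLinearMap.adjoint B‖ ^ 2) / 2))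
        have h1 := (ContinuousLinearMap.adjoint B).le_opNorm (v j)
        rw [v.orthonormal.1 j, mul_one] at h1
        have := ht j
        gcongr
    refine hg.of_norm_bounded fun p => ?_
    simp only [f, norm_mul, Complex.norm_real, Real.norm_eq_abs, abs_of_nonneg (ht p.1)]
    refine mul_le_mul_of_nonneg_left ?_ (ht p.1)
    rw [hadj, norm_inner_symm (ContinuousLinearMap.adjoint B (v p.1))]
    nlinarith [sq_nonneg (‖⟪e p.2, v p.1⟫_ℂ‖ -
      ‖⟪e p.2, ContinuousLinearMap.adjoint B (v p.1)⟫_ℂ‖)]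
  have hcol (i : ι) : HasSum (fun j => f (j, i)) ⟪e i, T (B (e i))⟫_ℂ := by
    have h1 := v.hasSum_inner_mul_inner (e i) (T (B (e i)))
    refine (hasSum_congr fun j => ?_).mp h1
    have h2 := hT.isSymmetric (v j) (B (e i))
    simp only [ContinuousLinearMap.coe_coe] at h2
    rw [← h2, hv, inner_smul_left, Complex.conj_ofReal]
    exact mul_left_comm _ _ _
  have h := hsum.hasSum
  have h1 := h.prod_fiberwise hrow
  have h2 := ((Equiv.prodComm ι κ).hasSum_iff.2 h).prod_fiberwise hcol
  rwa [← h1.tsum_eq] at h2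

theorem isTraceClass_iff_of_isPositive [CompleteSpace E] {T : E →L[ℂ] E} (hT : T.IsPositive) :
    IsTraceClass T ↔ Summable fun i => (⟪onb E i, T (onb E i)⟫_ℂ).re := by
  rw [IsTraceClass, CFC.abs_of_nonneg T ((ContinuousLinearMap.nonneg_iff_isPositive T).2 hT)]

/-- A non-negative trace class operator has a Hilbert basis of eigenvectors, with summable
eigenvalues. -/
theorem exists_eigenbasis [CompleteSpace E] {T : E →L[ℂ] E} (hT : T.IsPositive)
    (htr : IsTraceClass T) : ∃ (ι : Type u) (v : HilbertBasis ι ℂ E) (t : ι → ℝ),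
      (∀ j, 0 ≤ t j) ∧ Summable t ∧ ∀ j, T (v j) = (t j : ℂ) • v j := by
  rw [isTraceClass_iff_of_isPositive hT] at htr
  obtain ⟨ι, v, t, hv⟩ := exists_hilbertBasis_eigenvectors
    (isCompactOperator_of_summable_inner (onb E) hT htr) hT.isSymmetric
  have ht (j : ι) : ⟪v j, T (v j)⟫_ℂ = t j := by
    rw [hv, inner_smul_right, inner_self_eq_norm_sq_to_K, v.orthonormal.1 j]
    simp
  have ht0 (j : ι) : 0 ≤ t j := ht j ▸ hT.inner_nonneg_right (v j)
  have hre (j : ι) : ((t j).re : ℂ) = t j := (Complex.nonneg_iff.1 (ht0 j)).2 |> fun h =>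
    Complex.ext (by simp) (by simp [← h])
  refine ⟨ι, v, fun j => (t j).re, fun j => (Complex.nonneg_iff.1 (ht0 j)).1, ?_,
    fun j => by rw [hv, hre]⟩
  have hT0 : 0 ≤ T := (ContinuousLinearMap.nonneg_iff_isPositive T).2 hT
  obtain ⟨R, hR, hRR⟩ : ∃ R : E →L[ℂ] E, IsSelfAdjoint R ∧ R * R = T :=
    ⟨CFC.sqrt T, IsSelfAdjoint.of_nonneg (CFC.sqrt_nonneg T), CFC.sqrt_mul_sqrt_self T hT0⟩
  have hRn (x : E) : (⟪x, T x⟫_ℂ).re = ‖R x‖ ^ 2 := by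
    rw [← hRR, re_inner_sq_eq hR]
  have hsymm (x y : E) : ‖⟪x, R y⟫_ℂ‖ ^ 2 = ‖⟪y, R x⟫_ℂ‖ ^ 2 := by
    have := hR.isSymmetric x y
    simp only [ContinuousLinearMap.coe_coe] at this
    rw [← this, norm_inner_symm]
  -- The double series `|⟪vⱼ, R eᵢ⟫|²` with `R² = T` sums over `j` to `⟪eᵢ, T eᵢ⟫` and over `i` to
  -- the eigenvalue `tⱼ`, so summability passes from the former to the latter.
  have h1 : Summable fun p : basisIndex E × ι => ‖⟪v p.2, R (onb E p.1)⟫_ℂ‖ ^ 2 := by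
    refine (summable_prod_of_nonneg fun p => sq_nonneg _).2
      ⟨fun i => (hasSum_norm_sq_inner v (R (onb E i))).summable, htr.congr fun i => ?_⟩
    rw [(hasSum_norm_sq_inner v (R (onb E i))).tsum_eq, hRn]
  have h2 : Summable fun p : ι × basisIndex E => ‖⟪v p.1, R (onb E p.2)⟫_ℂ‖ ^ 2 :=
    (Equiv.prodComm ι (basisIndex E)).summable_iff.2 h1
  have h3 : Summable fun j => ∑' i, ‖⟪v j, R (onb E i)⟫_ℂ‖ ^ 2 := h2.prod
  refine h3.congr fun j => ?_
  have h4 : ∑' i, ‖⟪v j, R (onb E i)⟫_ℂ‖ ^ 2 = ‖R (v j)‖ ^ 2 := by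
    rw [← (hasSum_norm_sq_inner (onb E) (R (v j))).tsum_eq]
    exact tsum_congr fun i => hsymm (v j) (onb E i)
  rw [h4, ← hRn, ht]

theorem trace_mul_of_eigenvectors {κ : Type*} [CompleteSpace E] (v : HilbertBasis κ ℂ E)
    {t : κ → ℝ} (ht : ∀ j, 0 ≤ t j) (hts : Summable t) {T : E →L[ℂ] E} (hT : T.IsPositive)
    (hv : ∀ j, T (v j) = (t j : ℂ) • v j) (B : E →L[ℂ] E) :
    trace (T * B) = ∑' j, (t j : ℂ) * ⟪v j, B (v j)⟫_ℂ :=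
  (hasSum_trace_of_eigenvectors v ht hts hT hv (onb E) B).tsum_eq

theorem trace_of_eigenvectors {κ : Type*} [CompleteSpace E] (v : HilbertBasis κ ℂ E)
    {t : κ → ℝ} (ht : ∀ j, 0 ≤ t j) (hts : Summable t) {T : E →L[ℂ] E} (hT : T.IsPositive)
    (hv : ∀ j, T (v j) = (t j : ℂ) • v j) : trace T = ∑' j, (t j : ℂ) := by
  have h := trace_mul_of_eigenvectors v ht hts hT hv 1
  rw [mul_one] at h
  rw [h]
  refine tsum_congr fun j => ?_
  simp [inner_self_eq_norm_sq_to_K, v.orthonormal.1 j]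

/-- The trace of `T B` may be computed in any Hilbert basis. -/
theorem hasSum_trace_mul {ι : Type*} [CompleteSpace E] {T : E →L[ℂ] E} (hT : T.IsPositive)
    (htr : IsTraceClass T) (e : HilbertBasis ι ℂ E) (B : E →L[ℂ] E) :
    HasSum (fun i => ⟪e i, T (B (e i))⟫_ℂ) (trace (T * B)) := by
  obtain ⟨κ, v, t, ht, hts, hv⟩ := exists_eigenbasis hT htr
  rw [trace_mul_of_eigenvectors v ht hts hT hv]
  exact hasSum_trace_of_eigenvectors v ht hts hT hv e B

/-- The diagonal operator with given summable non-negative eigenvalues. -/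
theorem exists_isPositive_of_eigenvalues {κ : Type*} [CompleteSpace E] (v : HilbertBasis κ ℂ E)
    {t : κ → ℝ} (ht : ∀ j, 0 ≤ t j) (hts : Summable t) :
    ∃ T : E →L[ℂ] E, T.IsPositive ∧ IsTraceClass T ∧ ∀ j, T (v j) = (t j : ℂ) • v j := by
  classical
  have hs : Summable fun j => (t j : ℂ) • InnerProductSpace.rankOne ℂ (v j) (v j) := by
    refine hts.of_norm_bounded fun j => ?_
    rw [norm_smul, InnerProductSpace.norm_rankOne, v.orthonormal.1 j]
    simp [abs_of_nonneg (ht j)]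
  set T := ∑' j, (t j : ℂ) • InnerProductSpace.rankOne ℂ (v j) (v j) with hTdef
  have hTx (x : E) : HasSum (fun j => (t j : ℂ) • ⟪v j, x⟫_ℂ • v j) (T x) := by
    exact hs.hasSum.mapL (ContinuousLinearMap.apply ℂ E x)
  have hpos : T.IsPositive := by
    rw [ContinuousLinearMap.isPositive_iff_complex]
    intro x
    have h1 : HasSum (fun j => ((t j * ‖⟪v j, x⟫_ℂ‖ ^ 2 : ℝ) : ℂ)) ⟪x, T x⟫_ℂ := by
      have := (hTx x).mapL (innerSL ℂ x)
      refine (hasSum_congr fun j => ?_).mp this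
      simp only [map_smul, innerSL_apply_apply, smul_eq_mul]
      rw [mul_comm ⟪v j, x⟫_ℂ, inner_mul_inner_swap]
      push_cast
      rfl
    have h2 : 0 ≤ ⟪x, T x⟫_ℂ := h1.nonneg fun j => by
      have := ht j
      exact_mod_cast (by positivity : 0 ≤ t j * ‖⟪v j, x⟫_ℂ‖ ^ 2)
    have h3 := Complex.nonneg_iff.1 h2
    rw [← inner_conj_symm]
    exact ⟨Complex.ext (by simp) (by rw [Complex.conj_im, ← h3.2]; simp), h3.1⟩
  have hv (j : κ) : T (v j) = (t j : ℂ) • v j := by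
    refine (hTx (v j)).unique ?_
    refine (hasSum_congr fun i => ?_).mp (hasSum_ite_eq j ((t j : ℂ) • v j))
    rw [orthonormal_iff_ite.1 v.orthonormal]
    split_ifs with h
    · simp [h]
    · simp
  refine ⟨T, hpos, ?_, hv⟩
  rw [isTraceClass_iff_of_isPositive hpos]
  exact (Complex.hasSum_re
    (hasSum_trace_of_eigenvectors v ht hts hpos hv (onb E) 1).summable.hasSum).summable

end TraceClass

/-! ### Anticommutation relations and the occupation number basis -/

section Fock

theorem norm_eq_one_of_inner_self {E : Type*} [NormedAddCommGroup E] [InnerProductSpace ℂ E] {x : E}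
    (h : ⟪x, x⟫_ℂ = 1) : ‖x‖ = 1 := by
  have h' := congrArg Complex.re h
  rw [Complex.one_re] at h'
  have h2 : ‖x‖ ^ 2 = 1 := (@norm_sq_eq_re_inner ℂ _ _ _ _ x).trans h'
  exact (pow_eq_one_iff_of_nonneg (norm_nonneg _) two_ne_zero).1 h2

variable {H : Type u} [NormedAddCommGroup H] [InnerProductSpace ℂ H]

/-- The inclusion of the algebraic exterior power in the `n`-particle space. -/
noncomputable def toNParticle (n : ℕ) : ⋀[ℂ]^n H →ₗ[ℂ] NParticle H n :=
  (UniformSpace.Completion.toComplL (𝕜 := ℂ) (E := ⋀[ℂ]^n H)).toLinearMap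

theorem inner_toNParticle {n : ℕ} (x y : ⋀[ℂ]^n H) :
    ⟪toNParticle n x, toNParticle n y⟫_ℂ = form x y :=
  UniformSpace.Completion.inner_coe x y

theorem dense_toNParticle (n : ℕ) : DenseRange (toNParticle (H := H) n) :=
  UniformSpace.Completion.denseRange_coe

theorem creationSector_toNParticle (n : ℕ) (f : H) (x : ⋀[ℂ]^n H) :
    creationSector n f (toNParticle n x) = toNParticle (n + 1) (wedge n f x) :=
  ContinuousLinearMap.completion_apply_coe ((wedge n f).mkContinuous ‖f‖ (norm_wedge_le f)) x

/-- The inclusion of the algebraic exterior power in Fock space. -/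
noncomputable def toFock (n : ℕ) : ⋀[ℂ]^n H →ₗ[ℂ] Fock H :=
  (lp.lsingle 2 n : NParticle H n →ₗ[ℂ] Fock H) ∘ₗ toNParticle n

theorem toFock_apply (n : ℕ) (x : ⋀[ℂ]^n H) : toFock n x = lp.single 2 n (toNParticle n x) := rfl

theorem inner_toFock_left (n : ℕ) (x : ⋀[ℂ]^n H) (ψ : Fock H) :
    ⟪toFock n x, ψ⟫_ℂ = ⟪toNParticle n x, ψ n⟫_ℂ :=
  lp.inner_single_left n (toNParticle n x) ψ

theorem inner_toFock {n : ℕ} (x y : ⋀[ℂ]^n H) : ⟪toFock n x, toFock n y⟫_ℂ = form x y := by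
  rw [inner_toFock_left, toFock_apply, lp.single_apply_self, inner_toNParticle]

theorem inner_toFock_of_ne {m n : ℕ} (h : m ≠ n) (x : ⋀[ℂ]^m H) (y : ⋀[ℂ]^n H) :
    ⟪toFock m x, toFock n y⟫_ℂ = 0 := by
  rw [inner_toFock_left, toFock_apply, lp.single_apply_ne _ _ _ h, inner_zero_right]

/-- The algebraic exterior powers are dense in the `n`-particle spaces, hence total in Fock space.
-/
theorem eq_zero_of_inner_toFock {ψ : Fock H} (h : ∀ n (x : ⋀[ℂ]^n H), ⟪toFock n x, ψ⟫_ℂ = 0) :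
    ψ = 0 := by
  refine lp.ext (funext fun n => ?_)
  change ψ n = 0
  have hd : Dense (LinearMap.range (toNParticle (H := H) n) : Set (NParticle H n)) := by
    rw [LinearMap.coe_range]
    exact dense_toNParticle n
  refine hd.eq_zero_of_inner_left (𝕜 := ℂ) ?_
  rintro _ ⟨x, rfl⟩
  rw [← inner_conj_symm, ← inner_toFock_left, h, map_zero]

theorem fock_ext {ψ φ : Fock H} (h : ∀ n (x : ⋀[ℂ]^n H), ⟪toFock n x, ψ⟫_ℂ = ⟪toFock n x, φ⟫_ℂ) :
    ψ = φ :=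
  sub_eq_zero.1 <| eq_zero_of_inner_toFock fun n x => by rw [inner_sub_right, h, sub_self]

theorem clm_ext_toFock {A B : Fock H →L[ℂ] Fock H}
    (h : ∀ n (x : ⋀[ℂ]^n H), A (toFock n x) = B (toFock n x)) : A = B := by
  refine ContinuousLinearMap.ext fun ψ => fock_ext fun n x => ?_
  rw [← ContinuousLinearMap.adjoint_inner_left, ← ContinuousLinearMap.adjoint_inner_left]
  congr 1
  refine fock_ext fun m y => ?_
  rw [ContinuousLinearMap.adjoint_inner_right, ContinuousLinearMap.adjoint_inner_right, h]

theorem creation_toFock (f : H) (n : ℕ) (x : ⋀[ℂ]^n H) :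
    creation f (toFock n x) = toFock (n + 1) (wedge n f x) := by
  refine lp.ext (funext fun m => ?_)
  change creationComponent f (toFock n x) m = toFock (n + 1) (wedge n f x) m
  cases m with
  | zero =>
    rw [toFock_apply (n + 1), lp.single_apply_ne _ _ _ (Nat.succ_ne_zero n).symm]
    rfl
  | succ m =>
    change creationSector m f (toFock n x m) = _
    by_cases h : m = n
    · subst h
      rw [toFock_apply, toFock_apply, lp.single_apply_self, lp.single_apply_self,
        creationSector_toNParticle]
    · rw [toFock_apply, toFock_apply, lp.single_apply_ne _ _ _ h,
        lp.single_apply_ne _ _ _ (by omega), map_zero]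

theorem annihilation_toFock_zero (f : H) (x : ⋀[ℂ]^0 H) : annihilation f (toFock 0 x) = 0 := by
  refine eq_zero_of_inner_toFock fun n y => ?_
  rw [annihilation, ContinuousLinearMap.adjoint_inner_right, creation_toFock,
    inner_toFock_of_ne (Nat.succ_ne_zero n)]

theorem annihilation_toFock_succ (f : H) (n : ℕ) (x : ⋀[ℂ]^(n + 1) H) :
    annihilation f (toFock (n + 1) x) = toFock n (contract n f x) := by
  refine fock_ext fun m y => ?_
  rw [annihilation, ContinuousLinearMap.adjoint_inner_right, creation_toFock]
  by_cases h : m = n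
  · subst h
    rw [inner_toFock, inner_toFock, form_wedge_left]
  · rw [inner_toFock_of_ne (by omega), inner_toFock_of_ne h]

theorem adjoint_creation (f : H) : ContinuousLinearMap.adjoint (creation f) = annihilation f := rfl

theorem adjoint_annihilation (f : H) :
    ContinuousLinearMap.adjoint (annihilation f) = creation f :=
  ContinuousLinearMap.adjoint_adjoint _

/-- On each algebraic sector this is the antiderivation rule for contraction; the vacuum sector is
separate because nothing lies below it. -/
theorem annihilation_mul_creation (f g : H) :
    annihilation f * creation g = ⟪f, g⟫_ℂ • 1 - creation g * annihilation f := by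
  refine clm_ext_toFock fun n x => ?_
  simp only [mul_apply_eq_comp, sub_apply, smul_apply, one_apply_eq_self, creation_toFock,
    annihilation_toFock_succ]
  cases n with
  | zero => rw [contract_wedge_zero, annihilation_toFock_zero, map_zero, sub_zero, map_smul]
  | succ n =>
    rw [contract_wedge_succ, annihilation_toFock_succ, creation_toFock, map_sub, map_smul]

theorem wedge_wedge_self {n : ℕ} (f : H) (x : ⋀[ℂ]^n H) : wedge (n + 1) f (wedge n f x) = 0 := by
  induction x using ext_induction with
  | h v =>
    rw [wedge_ιMulti, wedge_ιMulti]
    exact AlternatingMap.map_eq_zero_of_eq _ _ (i := 0) (j := 1) (by simp) (by simp)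
  | h0 => simp
  | hadd x y hx hy => simp [hx, hy]
  | hsmul c x hx => simp [hx]

theorem creation_mul_self (f : H) : creation f * creation f = 0 := by
  refine clm_ext_toFock fun n x => ?_
  simp [creation_toFock, wedge_wedge_self]

theorem creation_add (f g : H) : creation (f + g) = creation f + creation g := by
  refine clm_ext_toFock fun n x => ?_
  simp [creation_toFock]

theorem creation_smul (c : ℂ) (f : H) : creation (c • f) = c • creation f := by
  refine clm_ext_toFock fun n x => ?_
  simp [creation_toFock]

theorem norm_creation_le (f : H) : ‖creation f‖ ≤ ‖f‖ :=
  ContinuousLinearMap.opNorm_le_bound _ (norm_nonneg f) (norm_creationLinear_le f)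

/-- The creation operators as a continuous linear map. -/
noncomputable def creationCLM : H →L[ℂ] Fock H →L[ℂ] Fock H :=
  LinearMap.mkContinuous
    { toFun := creation
      map_add' := creation_add
      map_smul' := creation_smul } 1 fun f => by simpa using norm_creation_le f

/-- Polarization of `a*(f)² = 0`. -/
theorem creation_mul_creation (f g : H) : creation f * creation g = -(creation g * creation f) := by
  have h := creation_mul_self (f + g)
  rw [creation_add, add_mul, mul_add, mul_add, creation_mul_self, creation_mul_self] at h
  rw [eq_neg_iff_add_eq_zero]
  simpa using h

theorem annihilation_mul_annihilation (f g : H) :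
    annihilation f * annihilation g = -(annihilation g * annihilation f) := by
  have h := congrArg star (creation_mul_creation g f)
  rw [star_neg, star_mul, star_mul] at h
  exact h

variable (H) in
/-- The vacuum vector. -/
noncomputable def vacuum : Fock H := toFock 0 (exteriorPower.ιMulti ℂ 0 Fin.elim0)

/-- The vector `a*(f₁) ⋯ a*(fₙ) Ω`. -/
noncomputable def fockVec (l : List H) : Fock H := l.foldr (fun f ψ => creation f ψ) (vacuum H)

theorem fockVec_nil : fockVec ([] : List H) = vacuum H := rfl

theorem fockVec_cons (f : H) (l : List H) : fockVec (f :: l) = creation f (fockVec l) := rfl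

theorem fockVec_ofFn : ∀ {n : ℕ} (v : Fin n → H),
    fockVec (List.ofFn v) = toFock n (exteriorPower.ιMulti ℂ n v)
  | 0, v => by
    rw [List.ofFn_zero, fockVec_nil, vacuum, Subsingleton.elim v Fin.elim0]
  | n + 1, v => by
    rw [List.ofFn_succ, fockVec_cons, fockVec_ofFn, creation_toFock, wedge_ιMulti]
    congr 2
    exact Fin.cons_self_tail v

theorem annihilation_vacuum (f : H) : annihilation f (vacuum H) = 0 := annihilation_toFock_zero f _

theorem norm_vacuum : ‖vacuum H‖ = 1 := by
  have h : ⟪vacuum H, vacuum H⟫_ℂ = 1 := by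
    rw [vacuum, inner_toFock, form_ιMulti, Matrix.det_isEmpty]
  exact norm_eq_one_of_inner_self h

section Basis

variable {ι : Type*} {b : ι → H}

theorem annihilation_creation_apply (f g : H) (ψ : Fock H) :
    annihilation f (creation g ψ) = ⟪f, g⟫_ℂ • ψ - creation g (annihilation f ψ) :=
  congrArg (fun A : Fock H →L[ℂ] Fock H => A ψ) (annihilation_mul_creation f g)

theorem creation_creation_apply (f g : H) (ψ : Fock H) :
    creation f (creation g ψ) = -creation g (creation f ψ) :=
  congrArg (fun A : Fock H →L[ℂ] Fock H => A ψ) (creation_mul_creation f g)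

theorem creation_creation_self_apply (f : H) (ψ : Fock H) : creation f (creation f ψ) = 0 :=
  congrArg (fun A : Fock H →L[ℂ] Fock H => A ψ) (creation_mul_self f)

open Classical in
/-- The vectors `a*(bᵢ₁) ⋯ a*(bᵢₙ) Ω` are eigenvectors of the number operators `a*(bᵢ) a(bᵢ)`. -/
theorem number_fockVec (hb : Orthonormal ℂ b) (i : ι) (l : List ι) :
    creation (b i) (annihilation (b i) (fockVec (l.map b))) =
      if i ∈ l then fockVec (l.map b) else 0 := by
  induction l with
  | nil => simp [fockVec_nil, annihilation_vacuum]
  | cons j l ih =>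
    rw [List.map_cons, fockVec_cons, annihilation_creation_apply, map_sub, map_smul,
      orthonormal_iff_ite.1 hb]
    by_cases h : i = j
    · subst h
      simp [creation_creation_self_apply]
    · rw [creation_creation_apply, ih]
      by_cases h' : i ∈ l <;> simp [h, h']

theorem annihilation_fockVec_of_notMem (hb : Orthonormal ℂ b) {i : ι} {l : List ι} (h : i ∉ l) :
    annihilation (b i) (fockVec (l.map b)) = 0 := by
  induction l with
  | nil => simp [fockVec_nil, annihilation_vacuum]
  | cons j l ih =>
    rw [List.mem_cons, not_or] at h
    rw [List.map_cons, fockVec_cons, annihilation_creation_apply, ih h.2,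
      hb.inner_eq_zero h.1]
    simp

/-- If `i` occurs in `l`, the vector of `l` is fixed by `a*(bᵢ) a(bᵢ)`, so a further `a*(bᵢ)` kills
it. -/
theorem fockVec_eq_zero (hb : Orthonormal ℂ b) {l : List ι} (h : ¬l.Nodup) :
    fockVec (l.map b) = 0 := by
  induction l with
  | nil => simp at h
  | cons i l ih =>
    rw [List.map_cons, fockVec_cons]
    by_cases hi : i ∈ l
    · have := number_fockVec hb i l
      rw [if_pos hi] at this
      rw [← this, creation_creation_self_apply]
    · rw [ih fun hl => h (List.nodup_cons.2 ⟨hi, hl⟩), map_zero]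

theorem norm_fockVec (hb : Orthonormal ℂ b) {l : List ι} (h : l.Nodup) :
    ‖fockVec (l.map b)‖ = 1 := by
  induction l with
  | nil => exact norm_vacuum
  | cons i l ih =>
    rw [List.nodup_cons] at h
    have h1 : ⟪fockVec ((i :: l).map b), fockVec ((i :: l).map b)⟫_ℂ =
        ⟪fockVec (l.map b), fockVec (l.map b)⟫_ℂ := by
      rw [List.map_cons, fockVec_cons, ← ContinuousLinearMap.adjoint_inner_right,
        adjoint_creation, annihilation_creation_apply, annihilation_fockVec_of_notMem hb h.1]
      simp [inner_self_eq_norm_sq_to_K, hb.1 i]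
    refine norm_eq_one_of_inner_self ?_
    rw [h1, inner_self_eq_norm_sq_to_K, ih h.2]
    simp

/-- The sign need not be tracked: only spans and diagonal matrix elements are used, so the arbitrary
order chosen by `Finset.toList` is harmless. -/
theorem fockVec_perm {l l' : List H} (h : l.Perm l') :
    fockVec l = fockVec l' ∨ fockVec l = -fockVec l' := by
  induction h with
  | nil => exact Or.inl rfl
  | cons f _ ih =>
    rw [fockVec_cons, fockVec_cons]
    rcases ih with ih | ih
    · exact Or.inl (by rw [ih])
    · exact Or.inr (by rw [ih, map_neg])
  | swap f g l =>
    simp only [fockVec_cons]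
    exact Or.inr (creation_creation_apply g f _)
  | trans _ _ ih ih' =>
    rcases ih with ih | ih <;> rcases ih' with ih' | ih' <;> simp [ih, ih']

/-- The vector of Fock space in which exactly the modes in `S` are occupied. -/
noncomputable def occupation (b : ι → H) (S : Finset ι) : Fock H := fockVec (S.toList.map b)

open Classical in
theorem number_occupation (hb : Orthonormal ℂ b) (i : ι) (S : Finset ι) :
    creation (b i) (annihilation (b i) (occupation b S)) = if i ∈ S then occupation b S else 0 := by
  rw [occupation, number_fockVec hb]
  simp

theorem inner_number_symm (f : H) (ψ φ : Fock H) :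
    ⟪creation f (annihilation f ψ), φ⟫_ℂ = ⟪ψ, creation f (annihilation f φ)⟫_ℂ := by
  rw [← ContinuousLinearMap.adjoint_inner_right, adjoint_creation,
    ← ContinuousLinearMap.adjoint_inner_right, adjoint_annihilation]

/-- The two vectors are eigenvectors of one symmetric number operator with eigenvalues 1 and 0. -/
theorem inner_occupation_of_mem (hb : Orthonormal ℂ b) {i : ι} {S S' : Finset ι} (h : i ∈ S)
    (h' : i ∉ S') : ⟪occupation b S, occupation b S'⟫_ℂ = 0 := by
  have := inner_number_symm (b i) (occupation b S) (occupation b S')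
  rwa [number_occupation hb, number_occupation hb, if_pos h, if_neg h', inner_zero_right] at this

theorem orthonormal_occupation (hb : Orthonormal ℂ b) : Orthonormal ℂ (occupation b) := by
  refine ⟨fun S => norm_fockVec hb S.nodup_toList, fun S S' hSS => ?_⟩
  have : ∃ i, ¬(i ∈ S ↔ i ∈ S') := by
    by_contra! h
    exact hSS (Finset.ext h)
  obtain ⟨i, hi⟩ := this
  by_cases h : i ∈ S
  · exact inner_occupation_of_mem hb h fun h' => hi ⟨fun _ => h', fun _ => h⟩
  · have h' : i ∈ S' := by
      by_contra h'
      exact hi ⟨fun k => (h k).elim, fun k => (h' k).elim⟩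
    change ⟪_, _⟫_ℂ = 0
    rw [← inner_conj_symm, inner_occupation_of_mem hb h' h, map_zero]

theorem fockVec_mem_span_occupation (hb : Orthonormal ℂ b) (l : List ι) :
    fockVec (l.map b) ∈ Submodule.span ℂ (Set.range (occupation b)) := by
  classical
  by_cases h : l.Nodup
  · have hp : l.Perm l.toFinset.toList := (List.toFinset_toList h).symm
    have hm : fockVec (l.toFinset.toList.map b) ∈ Submodule.span ℂ (Set.range (occupation b)) :=
      Submodule.subset_span ⟨l.toFinset, rfl⟩
    rcases fockVec_perm (hp.map b) with h | h <;> rw [h]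
    · exact hm
    · exact neg_mem hm
  · rw [fockVec_eq_zero hb h]
    exact zero_mem _

/-- The closed span of the basis words is invariant under every `a*(bᵢ)`. Since `f ↦ a*(f) ψ` is
linear and continuous, it is invariant under every `a*(f)`, and induction on the list applies. -/
theorem fockVec_mem_closure (b : HilbertBasis ι ℂ H) (l : List H) :
    fockVec l ∈ (Submodule.span ℂ (Set.range (occupation b))).topologicalClosure := by
  set M := Submodule.span ℂ (Set.range fun l : List ι => fockVec (l.map b)) with hM
  have hle : M ≤ Submodule.span ℂ (Set.range (occupation b)) := by
    rw [hM, Submodule.span_le]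
    rintro _ ⟨l, rfl⟩
    exact fockVec_mem_span_occupation b.orthonormal l
  refine Submodule.topologicalClosure_mono hle ?_
  have hcl : IsClosed (M.topologicalClosure : Set (Fock H)) := M.isClosed_topologicalClosure
  have hbasis (i : ι) : M.topologicalClosure ≤
      M.topologicalClosure.comap (creation (b i)).toLinearMap := by
    refine M.topologicalClosure_minimal ?_ (hcl.preimage (creation (b i)).continuous)
    rw [hM, Submodule.span_le]
    rintro _ ⟨l, rfl⟩
    exact M.le_topologicalClosure (Submodule.subset_span ⟨i :: l, rfl⟩)
  induction l with
  | nil => exact M.le_topologicalClosure (Submodule.subset_span ⟨[], rfl⟩)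
  | cons f l ih =>
    rw [fockVec_cons]
    let L : H →L[ℂ] Fock H := (ContinuousLinearMap.apply ℂ (Fock H) (fockVec l)).comp creationCLM
    have h1 : (Submodule.span ℂ (Set.range b)).topologicalClosure ≤
        M.topologicalClosure.comap L.toLinearMap := by
      refine Submodule.topologicalClosure_minimal _ ?_ (hcl.preimage L.continuous)
      rw [Submodule.span_le]
      rintro _ ⟨i, rfl⟩
      exact hbasis i ih
    rw [b.dense_span] at h1
    exact h1 (Submodule.mem_top : f ∈ ⊤)

/-- The occupation number basis of Fock space. -/
noncomputable def fockBasis (b : HilbertBasis ι ℂ H) : HilbertBasis (Finset ι) ℂ (Fock H) :=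
  HilbertBasis.mkOfOrthogonalEqBot (orthonormal_occupation b.orthonormal) <| by
    rw [Submodule.eq_bot_iff]
    intro ψ hψ
    refine eq_zero_of_inner_toFock fun n x => ?_
    rw [← Submodule.orthogonal_closure] at hψ
    induction x using ext_induction with
    | h v =>
      rw [← fockVec_ofFn]
      exact hψ _ (fockVec_mem_closure b _)
    | h0 => simp
    | hadd x y hx hy => rw [map_add, inner_add_left, hx, hy, add_zero]
    | hsmul c x hx => rw [map_smul, inner_smul_left, hx, mul_zero]

theorem fockBasis_apply (b : HilbertBasis ι ℂ H) (S : Finset ι) :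
    fockBasis b S = occupation b S :=
  congrFun (HilbertBasis.coe_mkOfOrthogonalEqBot _ _) S

theorem numberFunction_fockVec (c : ℕ → ℂ) (hc : ∀ n, ‖c n‖ ≤ 1) (l : List H) :
    numberFunction c hc (fockVec l) = c l.length • fockVec l := by
  obtain ⟨v, hv⟩ : ∃ v : Fin l.length → H, List.ofFn v = l := ⟨l.get, List.ofFn_get l⟩
  have h : fockVec l = toFock l.length (exteriorPower.ιMulti ℂ l.length v) := by
    rw [← fockVec_ofFn, hv]
  rw [h]
  refine lp.ext (funext fun m => ?_)
  change c m • toFock l.length (exteriorPower.ιMulti ℂ l.length v) m =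
    c l.length • toFock l.length (exteriorPower.ιMulti ℂ l.length v) m
  by_cases hm : m = l.length
  · rw [hm]
  · rw [toFock_apply, lp.single_apply_ne _ _ _ hm, smul_zero, smul_zero]

theorem numberFunction_occupation (c : ℕ → ℂ) (hc : ∀ n, ‖c n‖ ≤ 1) (b : ι → H) (S : Finset ι) :
    numberFunction c hc (occupation b S) = c S.card • occupation b S := by
  rw [occupation, numberFunction_fockVec]
  simp

end Basis

end Fock

/-! ### Words in the field operators, modulo shorter words -/

section Words

variable {H : Type u} [NormedAddCommGroup H] [InnerProductSpace ℂ H] {ι : Type*}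

/-- The field operator with label `(i, x)`: the creation operator of the mode `b i` if `x` is true,
the annihilation operator otherwise. -/
noncomputable def field (b : ι → H) (a : ι × Bool) : CAR H :=
  bif a.2 then aStar (b a.1) else aOp (b a.1)

/-- The product of the field operators in a list of labels. -/
noncomputable def word (b : ι → H) (w : List (ι × Bool)) : CAR H := (w.map (field b)).prod

/-- The labels of the product of the number operators of the modes in a list. -/
def numberWord (ks : List ι) : List (ι × Bool) := ks.flatMap fun k => [(k, true), (k, false)]

open Classical in
/-- The charge of a label with respect to the mode `i`. -/
noncomputable def labelCharge (i : ι) (a : ι × Bool) : ℤ :=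
  if a.1 = i then (bif a.2 then 1 else -1) else 0

/-- The charge of a word with respect to the mode `i`. -/
noncomputable def charge (i : ι) (w : List (ι × Bool)) : ℤ := (w.map (labelCharge i)).sum

variable {b : ι → H}

@[simp] theorem field_true (i : ι) : field b (i, true) = aStar (b i) := rfl

@[simp] theorem field_false (i : ι) : field b (i, false) = aOp (b i) := rfl

theorem word_nil : word b [] = 1 := rfl

theorem word_cons (a : ι × Bool) (w : List (ι × Bool)) : word b (a :: w) = field b a * word b w :=
  List.prod_cons

theorem numberWord_cons (k : ι) (ks : List ι) :
    numberWord (k :: ks) = (k, true) :: (k, false) :: numberWord ks := rfl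

theorem charge_cons (i : ι) (a : ι × Bool) (w : List (ι × Bool)) :
    charge i (a :: w) = labelCharge i a + charge i w :=
  List.sum_cons

theorem isFieldOperator_field (a : ι × Bool) : IsFieldOperator (field b a) := by
  obtain ⟨i, x⟩ := a
  cases x
  · exact Or.inr ⟨b i, rfl⟩
  · exact Or.inl ⟨b i, rfl⟩

theorem aOp_mul_aStar (f g : H) : aOp f * aStar g = ⟪f, g⟫_ℂ • (1 : CAR H) - aStar g * aOp f :=
  Subtype.ext (annihilation_mul_creation f g)

theorem aStar_mul_aStar (f g : H) : aStar f * aStar g = -(aStar g * aStar f) :=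
  Subtype.ext (creation_mul_creation f g)

theorem aOp_mul_aOp (f g : H) : aOp f * aOp g = -(aOp g * aOp f) :=
  Subtype.ext (annihilation_mul_annihilation f g)

theorem aStar_mul_self (f : H) : aStar f * aStar f = 0 := Subtype.ext (creation_mul_self f)

theorem star_aStar (f : H) : star (aStar f) = aOp f :=
  Subtype.ext (ContinuousLinearMap.star_eq_adjoint (creation f))

theorem star_aOp (f : H) : star (aOp f) = aStar f := by
  rw [← star_aStar, star_star]

theorem exists_field_mul_field (a a' : ι × Bool) :
    ∃ c : ℂ, field b a * field b a' = c • (1 : CAR H) - field b a' * field b a := by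
  obtain ⟨i, x⟩ := a
  obtain ⟨j, y⟩ := a'
  cases x <;> cases y
  · refine ⟨0, ?_⟩
    rw [field_false, field_false, zero_smul, zero_sub, aOp_mul_aOp]
  · refine ⟨⟪b i, b j⟫_ℂ, ?_⟩
    rw [field_false, field_true, aOp_mul_aStar]
  · refine ⟨⟪b j, b i⟫_ℂ, ?_⟩
    rw [field_false, field_true, aOp_mul_aStar, sub_sub_cancel]
  · refine ⟨0, ?_⟩
    rw [field_true, field_true, zero_smul, zero_sub, aStar_mul_aStar]

variable (b) in
/-- The span of the words of length less than `n`. -/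
noncomputable def wordSpan (n : ℕ) : Submodule ℂ (CAR H) :=
  Submodule.span ℂ {A | ∃ w : List (ι × Bool), w.length < n ∧ word b w = A}

theorem field_mul_mem_wordSpan (a : ι × Bool) {n : ℕ} {A : CAR H} (h : A ∈ wordSpan b n) :
    field b a * A ∈ wordSpan b (n + 1) := by
  induction h using Submodule.span_induction with
  | mem A hA =>
    obtain ⟨w, hw, rfl⟩ := hA
    exact Submodule.subset_span ⟨a :: w, by simpa using hw, word_cons a w⟩
  | zero => rw [mul_zero]; exact zero_mem _
  | add A B _ _ hA hB => rw [mul_add]; exact add_mem hA hB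
  | smul c A _ hA => rw [mul_smul_comm]; exact Submodule.smul_mem _ c hA

/-- A permutation changes a word by a sign, up to shorter words. -/
theorem word_perm {w w' : List (ι × Bool)} (h : w.Perm w') :
    word b w - word b w' ∈ wordSpan b w.length ∨ word b w + word b w' ∈ wordSpan b w.length := by
  induction h with
  | nil => exact Or.inl (by simp)
  | cons a _ ih =>
    rw [word_cons, word_cons, List.length_cons, ← mul_sub, ← mul_add]
    exact ih.imp (field_mul_mem_wordSpan a) (field_mul_mem_wordSpan a)
  | swap a a' l =>
    refine Or.inr ?_
    -- The anticommutator is a scalar, so the error is a multiple of a word shorter by two letters.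
    obtain ⟨c, hc⟩ := exists_field_mul_field (b := b) a' a
    have : word b (a' :: a :: l) + word b (a :: a' :: l) = c • word b l := by
      simp only [word_cons, ← mul_assoc]
      rw [hc, sub_mul, sub_add_cancel, smul_mul_assoc, one_mul]
    rw [this]
    exact Submodule.smul_mem _ _ (Submodule.subset_span ⟨l, by simp, rfl⟩)
  | @trans w₁ w₂ w₃ h₁ _ ih ih' =>
    rw [← h₁.length_eq] at ih'
    rcases ih with ih | ih <;> rcases ih' with ih' | ih'
    · exact Or.inl (by simpa using add_mem ih ih')
    · exact Or.inr (by convert add_mem ih ih' using 1; abel)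
    · exact Or.inr (by convert sub_mem ih ih' using 1; abel)
    · exact Or.inl (by convert sub_mem ih ih' using 1; abel)

theorem charge_eq_count [DecidableEq ι] (i : ι) (w : List (ι × Bool)) :
    charge i w = (w.count (i, true) : ℤ) - w.count (i, false) := by
  induction w with
  | nil => rfl
  | cons a w ih =>
    obtain ⟨j, x⟩ := a
    rw [charge_cons, ih, List.count_cons, List.count_cons]
    by_cases h : j = i <;> cases x <;> simp [labelCharge, h] <;> ring

theorem count_numberWord [DecidableEq ι] (a : ι × Bool) (ks : List ι) :
    (numberWord ks).count a = ks.count a.1 := by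
  induction ks with
  | nil => rfl
  | cons k ks ih =>
    obtain ⟨i, x⟩ := a
    rw [numberWord_cons, List.count_cons, List.count_cons, List.count_cons, ih]
    by_cases h : k = i <;> cases x <;> simp [h]

theorem count_map_filter [DecidableEq ι] (i : ι) (w : List (ι × Bool)) :
    ((w.filter Prod.snd).map Prod.fst).count i = w.count (i, true) := by
  induction w with
  | nil => rfl
  | cons a w ih =>
    obtain ⟨j, x⟩ := a
    cases x
    · simp [ih]
    · by_cases h : j = i <;> simp [ih, h]

/-- Zero charge means that each mode is created as often as it is annihilated; `ks` lists the
created modes with multiplicity. -/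
theorem exists_perm_numberWord {w : List (ι × Bool)} (h : ∀ i, charge i w = 0) :
    ∃ ks, w.Perm (numberWord ks) := by
  classical
  refine ⟨(w.filter Prod.snd).map Prod.fst, List.perm_iff_count.2 fun a => ?_⟩
  rw [count_numberWord, count_map_filter]
  obtain ⟨i, x⟩ := a
  have := h i
  rw [charge_eq_count] at this
  cases x
  · simp only
    omega
  · rfl

theorem exists_perm_of_two_le_count [DecidableEq ι] {a : ι × Bool} {w : List (ι × Bool)}
    (h : 2 ≤ w.count a) : ∃ w', w.Perm (a :: a :: w') := by
  have h1 : a ∈ w := List.count_pos_iff.1 (by omega)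
  have h2 : a ∈ w.erase a := List.count_pos_iff.1 (by rw [List.count_erase_self]; omega)
  exact ⟨(w.erase a).erase a,
    (List.perm_cons_erase h1).trans ((List.perm_cons_erase h2).cons a)⟩

/-- A linear functional on the CAR algebra that vanishes on the words with a nonzero charge and on
the products of distinct number operators vanishes on all words. -/
theorem apply_word_eq_zero (φ : CAR H →ₗ[ℂ] ℂ)
    (h1 : ∀ i w, charge i w ≠ 0 → φ (word b w) = 0)
    (h2 : ∀ ks : List ι, ks.Nodup → φ (word b (numberWord ks)) = 0) (w : List (ι × Bool)) :
    φ (word b w) = 0 := by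
  classical
  induction hn : w.length using Nat.strong_induction_on generalizing w with
  | _ n ih =>
    -- By the induction hypothesis `φ` kills all shorter words, so under `φ` the letters of `w`
    -- anticommute and may be rearranged up to sign.
    have hV : ∀ A ∈ wordSpan b n, φ A = 0 := by
      intro A hA
      induction hA using Submodule.span_induction with
      | mem A hA =>
        obtain ⟨w', hw', rfl⟩ := hA
        exact ih _ hw' w' rfl
      | zero => exact map_zero φ
      | add A B _ _ hA hB => rw [map_add, hA, hB, add_zero]
      | smul c A _ hA => rw [map_smul, hA, smul_zero]
    have hperm {w' : List (ι × Bool)} (hp : w.Perm w') (h0 : φ (word b w') = 0) :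
        φ (word b w) = 0 := by
      rcases word_perm (b := b) hp with h | h
      · have h' := hV _ (hn ▸ h : word b w - word b w' ∈ wordSpan b n)
        rwa [map_sub, h0, sub_zero] at h'
      · have h' := hV _ (hn ▸ h : word b w + word b w' ∈ wordSpan b n)
        rwa [map_add, h0, add_zero] at h'
    by_cases hc : ∃ i, charge i w ≠ 0
    · obtain ⟨i, hi⟩ := hc
      exact h1 i w hi
    push Not at hc
    obtain ⟨ks, hks⟩ := exists_perm_numberWord hc
    by_cases hnd : ks.Nodup
    · exact hperm hks (h2 ks hnd)
    · rw [List.nodup_iff_count_le_one] at hnd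
      push Not at hnd
      obtain ⟨k, hk⟩ := hnd
      -- A repeated mode allows two equal creation operators to be moved next to each other, where
      -- their product is 0.
      have : 2 ≤ w.count (k, true) := by
        rw [hks.count_eq, count_numberWord]
        exact hk
      obtain ⟨w', hw'⟩ := exists_perm_of_two_le_count this
      refine hperm hw' ?_
      rw [word_cons, word_cons, ← mul_assoc, field_true, aStar_mul_self, zero_mul, map_zero]

end Words

/-! ### Consequences of Wick's formula -/

section Wick

variable {H : Type u} [NormedAddCommGroup H] [InnerProductSpace ℂ H] {ι : Type*} {b : ι → H}
  {ω : CAR H →ₗ[ℂ] ℂ}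

/-- Positivity of `(1 + cA)* (1 + cA)` makes `c ω(A) + c̄ ω(A*)` real; `c = 1` and `c = I` determine
the imaginary and real parts. -/
theorem IsState.apply_star (hω : IsState ω) (A : CAR H) : ω (star A) = starRingEnd ℂ (ω A) := by
  have him (c : ℂ) : (c * ω A + starRingEnd ℂ c * ω (star A)).im = 0 := by
    have h1 := (Complex.nonneg_iff.1 (hω.nonneg (1 + c • A))).2
    have h2 := (Complex.nonneg_iff.1 (hω.nonneg A)).2
    have h3 : star (1 + c • A) * (1 + c • A) =
        1 + c • A + starRingEnd ℂ c • star A + (starRingEnd ℂ c * c) • (star A * A) := by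
      rw [star_add, star_one, star_smul, add_mul, one_mul, mul_add, mul_one, smul_mul_smul_comm]
      simp only [Complex.star_def]
      abel
    rw [h3, map_add, map_add, map_add, map_smul, map_smul, map_smul, hω.map_one,
      ← Complex.normSq_eq_conj_mul_self] at h1
    simp only [Complex.add_im, Complex.one_im, smul_eq_mul, Complex.im_ofReal_mul, ← h2] at h1 ⊢
    simpa using h1.symm
  have e1 := him 1
  have e2 := him Complex.I
  simp at e1 e2
  apply Complex.ext
  · simp; linarith
  · simp; linarith

/-- The two-point functions of the field operators in the modes `b i`, for a gauge-invariant state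
whose one-particle density matrix is diagonal with eigenvalues `lam i`. -/
structure IsDiagonalTwoPoint (ω : CAR H →ₗ[ℂ] ℂ) (b : ι → H) (lam : ι → ℝ) : Prop where
  number : ∀ i, ω (aStar (b i) * aOp (b i)) = lam i
  eq_zero : ∀ a a' : ι × Bool, (a.1 ≠ a'.1 ∨ a.2 = a'.2) → ω (field b a * field b a') = 0

theorem isDiagonalTwoPoint (hω : IsState ω) {γ : H →L[ℂ] H} (hγ : IsOnePDM ω γ)
    (hα : ∀ f g, ω (aStar f * aStar g) = 0) (hb : Orthonormal ℂ b) {lam : ι → ℝ}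
    (hlam : ∀ i, γ (b i) = (lam i : ℂ) • b i) : IsDiagonalTwoPoint ω b lam := by
  classical
  have hg (i j : ι) : ω (aStar (b i) * aOp (b j)) = if j = i then (lam i : ℂ) else 0 := by
    rw [← hγ, hlam, inner_smul_right, orthonormal_iff_ite.1 hb]
    simp
  refine ⟨fun i => by rw [hg, if_pos rfl], ?_⟩
  rintro ⟨i, x⟩ ⟨j, y⟩ h
  cases x <;> cases y
  -- A product of two annihilation operators is the adjoint of a product of two creation operators,
  -- where `α = 0` applies.
  · have := hω.apply_star (aStar (b j) * aStar (b i))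
    rw [star_mul, star_aStar, star_aStar, hα, map_zero] at this
    rw [field_false, field_false]
    exact this
  · have hij : i ≠ j := by simpa using h
    rw [field_true, field_false, aOp_mul_aStar, hb.inner_eq_zero hij, map_sub, zero_smul, map_zero,
      hg, if_neg hij, sub_zero]
  · have hij : i ≠ j := by simpa using h
    rw [field_true, field_false, hg, if_neg hij.symm]
  · rw [field_true, field_true]
    exact hα _ _

theorem sum_fin_two_mul {M : Type*} [AddCommMonoid M] {p : ℕ} (f : Fin (2 * p) → M) :
    ∑ q, f q = ∑ j : Fin p, (f ⟨2 * j, by omega⟩ + f ⟨2 * j + 1, by omega⟩) := by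
  rw [← List.sum_ofFn, List.ofFn_mul', List.sum_flatten, List.map_ofFn, List.sum_ofFn]
  refine Finset.sum_congr rfl fun j _ => ?_
  simp [List.ofFn_succ]

theorem labelCharge_add {a a' : ι × Bool} (i : ι) (h : ¬(a.1 ≠ a'.1 ∨ a.2 = a'.2)) :
    labelCharge i a + labelCharge i a' = 0 := by
  obtain ⟨j, x⟩ := a
  obtain ⟨k, y⟩ := a'
  simp only [ne_eq, not_or, not_not] at h
  obtain ⟨rfl, h⟩ := h
  by_cases hi : j = i <;> cases x <;> cases y <;> simp_all [labelCharge]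

/-- A nonzero term of Wick's formula pairs each creation operator with an annihilation operator of
the same mode. Every pair then has charge 0, and so has the word. -/
theorem IsQuasiFree.apply_word_eq_zero_of_charge (hω : IsQuasiFree ω) {lam : ι → ℝ}
    (h2 : IsDiagonalTwoPoint ω b lam) (i : ι) (w : List (ι × Bool)) (hw : charge i w ≠ 0) :
    ω (word b w) = 0 := by
  classical
  rcases Nat.even_or_odd' w.length with ⟨p, hp | hp⟩
  · let e : Fin (2 * p) → ι × Bool := fun q => w.get (q.cast hp.symm)
    have he : List.ofFn e = w := by
      conv_rhs => rw [← List.ofFn_get w, List.ofFn_congr hp]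
    have hwe : word b w = (List.ofFn fun q => field b (e q)).prod := by
      rw [word, ← he, List.map_ofFn]
      rfl
    rw [hwe, hω.wick p _ fun q => isFieldOperator_field _]
    refine Finset.sum_eq_zero fun π _ => ?_
    suffices ∃ j : Fin p, ω (field b (e (π ⟨2 * j, by omega⟩)) *
        field b (e (π ⟨2 * j + 1, by omega⟩))) = 0 by
      obtain ⟨j, hj⟩ := this
      rw [Finset.prod_eq_zero (Finset.mem_univ j) hj, mul_zero]
    by_contra! hne
    apply hw
    rw [← he, charge, List.map_ofFn, List.sum_ofFn, ← Equiv.sum_comp π, sum_fin_two_mul]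
    refine Finset.sum_eq_zero fun j _ => ?_
    exact labelCharge_add i fun h => hne j (h2.eq_zero _ _ h)
  · let e : Fin (2 * p + 1) → ι × Bool := fun q => w.get (q.cast hp.symm)
    have he : List.ofFn e = w := by
      conv_rhs => rw [← List.ofFn_get w, List.ofFn_congr hp]
    have hwe : word b w = (List.ofFn fun q => field b (e q)).prod := by
      rw [word, ← he, List.map_ofFn]
      rfl
    rw [hwe]
    exact hω.odd p _ fun q => isFieldOperator_field _

theorem isPairing_one (p : ℕ) : IsPairing (1 : Equiv.Perm (Fin (2 * p))) := by
  refine ⟨fun i j hij => ?_, fun j => ?_⟩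
  · simpa using hij
  · simp

/-- Each pair fills a block `{2m, 2m + 1}` in increasing order, and the block number `m j` is
strictly increasing on `Fin p`, hence the identity. -/
theorem perm_eq_one_of_isPairing {p : ℕ} {π : Equiv.Perm (Fin (2 * p))} (hπ : IsPairing π)
    (h : ∀ j : Fin p, (π ⟨2 * j, by omega⟩ : ℕ) / 2 = (π ⟨2 * j + 1, by omega⟩ : ℕ) / 2) :
    π = 1 := by
  let m : Fin p → Fin p := fun j => ⟨(π ⟨2 * j, by omega⟩ : ℕ) / 2, by omega⟩
  have h0 (j : Fin p) : (π ⟨2 * j, by omega⟩ : ℕ) = 2 * m j := by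
    have h1 := h j
    have h2 : (π ⟨2 * j, by omega⟩ : ℕ) < π ⟨2 * j + 1, by omega⟩ := hπ.2 j
    simp only [m]
    omega
  have h1 (j : Fin p) : (π ⟨2 * j + 1, by omega⟩ : ℕ) = 2 * m j + 1 := by
    have h1 := h j
    have h2 : (π ⟨2 * j, by omega⟩ : ℕ) < π ⟨2 * j + 1, by omega⟩ := hπ.2 j
    simp only [m]
    omega
  have hm : StrictMono m := by
    intro i j hij
    have h2 : (π ⟨2 * i, by omega⟩ : ℕ) < π ⟨2 * j, by omega⟩ := hπ.1 i j hij
    rw [h0, h0] at h2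
    exact Fin.lt_def.2 (by omega)
  have hid (j : Fin p) : m j = j :=
    le_antisymm hm.apply_le hm.le_apply
  ext q
  rw [Equiv.Perm.one_apply]
  rcases Nat.even_or_odd' (q : ℕ) with ⟨j, hj | hj⟩
  · have := h0 ⟨j, by omega⟩
    rw [hid] at this
    have hq : q = ⟨2 * j, by omega⟩ := Fin.ext hj
    rw [hq]
    exact this
  · have := h1 ⟨j, by omega⟩
    rw [hid] at this
    have hq : q = ⟨2 * j + 1, by omega⟩ := Fin.ext hj
    rw [hq]
    exact this

/-- Position `q` carries the mode number `q / 2`, created if `q` is even; this is the indexing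
needed for Wick's formula. -/
theorem map_numberWord {A : Type*} (f : ι × Bool → A) (ks : List ι) :
    (numberWord ks).map f = List.ofFn fun q : Fin (2 * ks.length) =>
      f (ks.get ⟨q / 2, by omega⟩, decide ((q : ℕ) % 2 = 0)) := by
  rw [List.ofFn_mul']
  conv_lhs => rw [← List.ofFn_get ks]
  rw [numberWord, List.flatMap_def, List.map_flatten, List.map_ofFn, List.map_ofFn]
  congr 2
  funext j
  simp [List.ofFn_succ, Nat.mul_add_div]

/-- The modes are distinct, so any pairing other than the identity contains a vanishing two-point
function between different modes. -/
theorem IsQuasiFree.apply_numberWord (hω : IsQuasiFree ω) {lam : ι → ℝ}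
    (h2 : IsDiagonalTwoPoint ω b lam) {ks : List ι} (hks : ks.Nodup) :
    ω (word b (numberWord ks)) = ((ks.map lam).prod : ℝ) := by
  classical
  rw [word, map_numberWord, hω.wick _ _ fun q => isFieldOperator_field _]
  rw [Finset.sum_eq_single 1]
  · rw [Equiv.Perm.sign_one]
    conv_rhs => rw [← List.ofFn_get ks, List.map_ofFn, List.prod_ofFn]
    simp only [Units.val_one, Int.cast_one, one_mul, Equiv.Perm.one_apply, Complex.ofReal_prod]
    refine Finset.prod_congr rfl fun j _ => ?_
    have e1 : 2 * (j : ℕ) / 2 = j := by omega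
    have e2 : (2 * (j : ℕ) + 1) / 2 = j := by omega
    have e3 : 2 * (j : ℕ) % 2 = 0 := by omega
    have e4 : (2 * (j : ℕ) + 1) % 2 = 1 := by omega
    simp only [e1, e2, e3, e4]
    simpa using h2.number _
  · intro π hπ hπ1
    rw [Finset.mem_filter_univ] at hπ
    suffices ∃ j : Fin ks.length, (π ⟨2 * j, by omega⟩ : ℕ) / 2 ≠
        (π ⟨2 * j + 1, by omega⟩ : ℕ) / 2 by
      obtain ⟨j, hj⟩ := this
      rw [Finset.prod_eq_zero (Finset.mem_univ j), mul_zero]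
      refine h2.eq_zero _ _ (Or.inl fun h => hj ?_)
      simpa using hks.injective_get h
    by_contra! h
    exact hπ1 (perm_eq_one_of_isPairing hπ h)
  · intro h
    exact absurd (Finset.mem_filter_univ _ |>.2 (isPairing_one _)) h

end Wick

/-! ### Diagonal matrix elements of words -/

section Diagonal

variable {H : Type u} [NormedAddCommGroup H] [InnerProductSpace ℂ H] {ι : Type*} {b : ι → H}

theorem coe_aStar (f : H) : ((aStar f : CAR H) : Fock H →L[ℂ] Fock H) = creation f := rfl

theorem coe_aOp (f : H) : ((aOp f : CAR H) : Fock H →L[ℂ] Fock H) = annihilation f := rfl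

/-- The commutator with a number operator measures the charge. -/
theorem number_mul_field (hb : Orthonormal ℂ b) (i : ι) (a : ι × Bool) :
    aStar (b i) * aOp (b i) * field b a =
      field b a * (aStar (b i) * aOp (b i)) + (labelCharge i a : ℂ) • field b a := by
  classical
  obtain ⟨j, x⟩ := a
  cases x
  · rw [field_false, mul_assoc, aOp_mul_aOp, mul_neg, ← mul_assoc, ← mul_assoc]
    have h := aOp_mul_aStar (b j) (b i)
    rw [eq_sub_iff_add_eq, ← eq_sub_iff_add_eq'] at h
    rw [h, sub_mul, orthonormal_iff_ite.1 hb, smul_mul_assoc, one_mul]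
    by_cases hij : j = i
    · subst hij
      simp [labelCharge, sub_eq_add_neg]
    · simp [labelCharge, hij]
  · rw [field_true, mul_assoc, aOp_mul_aStar, mul_sub, mul_smul_comm, mul_one, ← mul_assoc,
      aStar_mul_aStar, orthonormal_iff_ite.1 hb]
    by_cases hij : i = j
    · subst hij
      simp [labelCharge, mul_assoc, add_comm]
    · simp [labelCharge, hij, Ne.symm hij, mul_assoc]

theorem number_mul_word (hb : Orthonormal ℂ b) (i : ι) (w : List (ι × Bool)) :
    aStar (b i) * aOp (b i) * word b w =
      word b w * (aStar (b i) * aOp (b i)) + (charge i w : ℂ) • word b w := by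
  induction w with
  | nil => simp [word_nil, charge]
  | cons a w ih =>
    rw [word_cons, ← mul_assoc, number_mul_field hb, add_mul, mul_assoc _ _ (word b w), ih,
      charge_cons, mul_add, mul_smul_comm, smul_mul_assoc, Int.cast_add, add_smul]
    simp only [← mul_assoc]
    abel

/-- The commutator of the word with a number operator has zero expectation in an eigenvector of the
latter, yet it equals the charge times the word. -/
theorem inner_word_occupation_of_charge (hb : Orthonormal ℂ b) {i : ι} {w : List (ι × Bool)}
    (hw : charge i w ≠ 0) (S : Finset ι) :
    ⟪occupation b S, (word b w : Fock H →L[ℂ] Fock H) (occupation b S)⟫_ℂ = 0 := by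
  classical
  have h := congrArg (fun A : CAR H =>
    ⟪occupation b S, (A : Fock H →L[ℂ] Fock H) (occupation b S)⟫_ℂ) (number_mul_word hb i w)
  have h1 : ⟪occupation b S, creation (b i) (annihilation (b i)
      ((word b w : Fock H →L[ℂ] Fock H) (occupation b S)))⟫_ℂ =
      ⟪occupation b S, (word b w : Fock H →L[ℂ] Fock H) (creation (b i) (annihilation (b i)
        (occupation b S)))⟫_ℂ + (charge i w : ℂ) *
      ⟪occupation b S, (word b w : Fock H →L[ℂ] Fock H) (occupation b S)⟫_ℂ := by
    rw [← inner_smul_right, ← inner_add_right]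
    exact h
  rw [← inner_number_symm, number_occupation hb] at h1
  have hc : (charge i w : ℂ) ≠ 0 := by exact_mod_cast hw
  split_ifs at h1
  · simpa [hc] using h1
  · simpa [hc] using h1

open Classical in
theorem numberWord_occupation (hb : Orthonormal ℂ b) (ks : List ι) (S : Finset ι) :
    (word b (numberWord ks) : Fock H →L[ℂ] Fock H) (occupation b S) =
      if ∀ k ∈ ks, k ∈ S then occupation b S else 0 := by
  induction ks with
  | nil => simp [numberWord, word_nil]
  | cons k ks ih =>
    have h : (word b (numberWord (k :: ks)) : Fock H →L[ℂ] Fock H) (occupation b S) =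
        creation (b k) (annihilation (b k)
          ((word b (numberWord ks) : Fock H →L[ℂ] Fock H) (occupation b S))) := by
      rw [numberWord_cons, word_cons, word_cons]
      rfl
    rw [h, ih]
    by_cases h1 : ∀ k ∈ ks, k ∈ S
    · rw [if_pos h1, number_occupation hb]
      by_cases h2 : k ∈ S
      · rw [if_pos h2, if_pos (by simpa [h2] using h1)]
      · rw [if_neg h2, if_neg (by simp [h2])]
    · rw [if_neg h1, map_zero, map_zero, if_neg]
      exact fun h' => h1 fun k hk => h' k (List.mem_cons_of_mem _ hk)

end Diagonal

/-! ### Independent occupation of the modes -/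

section Weights

variable {ι : Type*}

open Classical in
/-- Expansion of an infinite product of sums over the finite sets in which the first summand is
chosen. -/
theorem hasSum_tprod_ite {x y : ι → ℝ} (hx0 : ∀ i, 0 ≤ x i) (hx : Summable x) (hy0 : ∀ i, 0 ≤ y i)
    (hy1 : ∀ i, y i ≤ 1) (hy : Summable fun i => 1 - y i) :
    HasSum (fun S : Finset ι => ∏' i, if i ∈ S then x i else y i) (∏' i, (x i + y i)) := by
  have hmul : Multipliable fun i => x i + y i := by
    have h := Real.multipliable_one_add_of_summable (hx.sub hy)
    refine h.congr fun i => ?_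
    ring
  have hmulS (S : Finset ι) : Multipliable fun i => if i ∈ S then x i else y i := by
    have h1 : Summable fun i => if i ∈ S then x i - 1 else 0 :=
      summable_of_ne_finset_zero (s := S) fun i hi => if_neg hi
    have h2 : Summable fun i => if i ∈ S then 0 else y i - 1 :=
      Summable.of_norm_bounded hy fun i => by
        split_ifs
        · simpa using hy1 i
        · rw [Real.norm_eq_abs, abs_sub_comm, abs_of_nonneg (sub_nonneg.2 (hy1 i))]
    refine (Real.multipliable_one_add_of_summable (h1.add h2)).congr fun i => ?_
    split_ifs <;> ring
  -- Truncation to the finite set `F`, where the expansion is `Finset.prod_add`. The terms are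
  -- dominated by the summable `∏ i ∈ S, x i`, so dominated convergence lets `F` grow.
  let f : Finset ι → Finset ι → ℝ := fun F S =>
    if S ⊆ F then ∏ i ∈ F, if i ∈ S then x i else y i else 0
  have hf (F S : Finset ι) (h : S ⊆ F) : f F S = (∏ i ∈ S, x i) * ∏ i ∈ F \ S, y i := by
    simp only [f, if_pos h]
    rw [Finset.prod_ite, Finset.filter_mem_eq_inter, Finset.inter_eq_right.2 h,
      ← Finset.sdiff_eq_filter]
  have hbound (F S : Finset ι) : ‖f F S‖ ≤ ∏ i ∈ S, x i := by
    by_cases h : S ⊆ F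
    · have h1 : 0 ≤ ∏ i ∈ S, x i := Finset.prod_nonneg fun i _ => hx0 i
      have h2 : 0 ≤ ∏ i ∈ F \ S, y i := Finset.prod_nonneg fun i _ => hy0 i
      rw [hf F S h, Real.norm_eq_abs, abs_of_nonneg (mul_nonneg h1 h2)]
      exact mul_le_of_le_one_right h1 (Finset.prod_le_one (fun i _ => hy0 i) fun i _ => hy1 i)
    · simp only [f, if_neg h, norm_zero]
      exact Finset.prod_nonneg fun i _ => hx0 i
  have hsum : Summable fun S : Finset ι => ∏ i ∈ S, x i :=
    summable_finsetProd_of_summable_nonneg hx0 hx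
  have hlim (S : Finset ι) :
      Tendsto (fun F => f F S) atTop (𝓝 (∏' i, if i ∈ S then x i else y i)) := by
    refine (hmulS S).hasProd.congr' ?_
    filter_upwards [eventually_ge_atTop S] with F hF
    exact (if_pos hF).symm
  have htot (F : Finset ι) : ∑' S, f F S = ∏ i ∈ F, (x i + y i) := by
    rw [tsum_eq_sum (s := F.powerset) fun S hS => if_neg (by simpa using hS), Finset.prod_add]
    exact Finset.sum_congr rfl fun S hS => hf F S (Finset.mem_powerset.1 hS)
  have h1 := tendsto_tsum_of_dominated_convergence hsum hlim
    (Eventually.of_forall fun F S => hbound F S)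
  simp_rw [htot] at h1
  have h2 : ∏' i, (x i + y i) = ∑' S : Finset ι, ∏' i, if i ∈ S then x i else y i :=
    tendsto_nhds_unique hmul.hasProd h1
  rw [h2]
  refine (hsum.of_norm_bounded fun S => ?_).hasSum
  exact le_of_tendsto (hlim S).norm (Eventually.of_forall fun F => hbound F S)

open Classical in
/-- The probability that exactly the modes in `S` are occupied, if the mode `i` is occupied with
probability `lam i`, independently of the other ones. -/
noncomputable def weight (lam : ι → ℝ) (S : Finset ι) : ℝ :=
  ∏' i, if i ∈ S then lam i else 1 - lam i

variable {lam : ι → ℝ}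

open Classical in
theorem multipliable_weight (hs : Summable lam) (S : Finset ι) :
    Multipliable fun i => if i ∈ S then lam i else 1 - lam i := by
  have h1 : Summable fun i => if i ∈ S then 2 * lam i - 1 else 0 :=
    summable_of_ne_finset_zero (s := S) fun i hi => if_neg hi
  refine (Real.multipliable_one_add_of_summable (h1.sub hs)).congr fun i => ?_
  split_ifs <;> ring

theorem weight_nonneg (h0 : ∀ i, 0 ≤ lam i) (h1 : ∀ i, lam i ≤ 1) (hs : Summable lam)
    (S : Finset ι) : 0 ≤ weight lam S := by
  classical
  refine ge_of_tendsto (multipliable_weight hs S).hasProd (Eventually.of_forall fun F => ?_)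
  refine Finset.prod_nonneg fun i _ => ?_
  split_ifs
  · exact h0 i
  · exact sub_nonneg.2 (h1 i)

theorem weight_eq_zero {S : Finset ι} {i : ι} (hi : lam i = 1) (hS : i ∉ S) : weight lam S = 0 := by
  classical
  exact tprod_of_exists_eq_zero ⟨i, by simp [hS, hi]⟩

/-- The infinite product is expanded with `x = z lam` and `y = 1 - lam`; each occupied mode
contributes one factor `z`. -/
theorem hasSum_pow_mul_weight (h0 : ∀ i, 0 ≤ lam i) (h1 : ∀ i, lam i ≤ 1) (hs : Summable lam)
    {z : ℝ} (hz : 0 ≤ z) :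
    HasSum (fun S => z ^ S.card * weight lam S) (∏' i, (1 + (z - 1) * lam i)) := by
  classical
  have h := hasSum_tprod_ite (x := fun i => z * lam i) (y := fun i => 1 - lam i)
    (fun i => mul_nonneg hz (h0 i)) (hs.mul_left z) (fun i => sub_nonneg.2 (h1 i))
    (fun i => sub_le_self _ (h0 i)) (by simpa using hs)
  have e : ∏' i, (1 + (z - 1) * lam i) = ∏' i, (z * lam i + (1 - lam i)) :=
    tprod_congr fun i => by ring
  rw [e]
  refine (hasSum_congr fun S => ?_).mp h
  have hfin : HasProd (fun i => if i ∈ S then z else 1) (z ^ S.card) := by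
    have : HasProd (fun i => if i ∈ S then z else 1) (∏ i ∈ S, if i ∈ S then z else 1) :=
      hasProd_prod_of_ne_finset_one fun i hi => if_neg hi
    rwa [Finset.prod_congr rfl fun i hi => if_pos hi, Finset.prod_const] at this
  have := (hfin.mul (multipliable_weight hs S).hasProd).tprod_eq
  rw [weight, ← this]
  refine tprod_congr fun i => ?_
  split_ifs <;> ring

open Classical in
-- Replacing `1 - lam i` by 0 on `K` removes exactly the sets that do not contain `K` from the
-- product expansion.
theorem hasSum_weight_of_subset (h0 : ∀ i, 0 ≤ lam i) (h1 : ∀ i, lam i ≤ 1) (hs : Summable lam)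
    (K : Finset ι) :
    HasSum (fun S => if K ⊆ S then weight lam S else 0) (∏ i ∈ K, lam i) := by
  have hy : Summable fun i => 1 - if i ∈ K then 0 else 1 - lam i := by
    have h1 : Summable fun i => if i ∈ K then 1 - lam i else 0 :=
      summable_of_ne_finset_zero (s := K) fun i hi => if_neg hi
    refine (h1.add hs).congr fun i => ?_
    split_ifs <;> ring
  have h := hasSum_tprod_ite (x := lam) (y := fun i => if i ∈ K then 0 else 1 - lam i) h0 hs
    (fun i => by
      split_ifs
      · exact le_rfl
      · exact sub_nonneg.2 (h1 i))
    (fun i => by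
      split_ifs
      · exact zero_le_one
      · exact sub_le_self _ (h0 i)) hy
  have e : ∏' i, (lam i + if i ∈ K then 0 else 1 - lam i) = ∏ i ∈ K, lam i := by
    rw [tprod_eq_prod (s := K) fun i hi => by simp [hi]]
    exact Finset.prod_congr rfl fun i hi => by simp [hi]
  rw [e] at h
  refine (hasSum_congr fun S => ?_).mp h
  split_ifs with hKS
  · refine tprod_congr fun i => ?_
    by_cases hi : i ∈ S
    · simp [hi]
    · simp [hi, show i ∉ K from fun hk => hi (hKS hk)]
  · obtain ⟨i, hiK, hiS⟩ := Finset.not_subset.1 hKS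
    exact tprod_of_exists_eq_zero ⟨i, by simp [hiK, hiS]⟩

open Classical in
-- Inclusion-exclusion, one mode at a time: the sets avoiding `b` are all sets minus those
-- containing `b`. Hence the sum of `d` over the sets that contain `S` and avoid `F \ S` is 0, and
-- as `F` grows only `S` itself remains.
theorem eq_zero_of_hasSum_superset {d : Finset ι → ℝ}
    (hd : ∀ K : Finset ι, HasSum (fun L => if K ⊆ L then d L else 0) 0) (S : Finset ι) : d S = 0 := by
  have hsum : Summable d := by simpa using (hd ∅).summable
  have key (B : Finset ι) : ∀ A : Finset ι,
      HasSum (fun L => if A ⊆ L ∧ Disjoint B L then d L else 0) 0 := by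
    induction B using Finset.induction_on with
    | empty => intro A; simpa using hd A
    | insert b B _ ih =>
      intro A
      have h := (ih A).sub (ih (insert b A))
      rw [sub_zero] at h
      refine (hasSum_congr fun L => ?_).mp h
      simp only [Finset.insert_subset_iff, Finset.disjoint_insert_left]
      by_cases h1 : b ∈ L <;> by_cases h2 : A ⊆ L <;> by_cases h3 : Disjoint B L <;>
        simp [h1, h2, h3]
  have hlim : Tendsto (fun F : Finset ι => ∑' L, if S ⊆ L ∧ Disjoint (F \ S) L then d L else 0)
      atTop (𝓝 (∑' L, if L = S then d L else 0)) := by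
    refine tendsto_tsum_of_dominated_convergence hsum.norm (fun L => ?_)
      (Eventually.of_forall fun F L => ?_)
    · refine tendsto_const_nhds.congr' ?_
      filter_upwards [eventually_ge_atTop L] with F hF
      refine if_congr ⟨?_, fun h => ?_⟩ rfl rfl
      · rintro rfl
        exact ⟨subset_rfl, Finset.sdiff_disjoint⟩
      · refine Finset.Subset.antisymm (fun i hi => ?_) h.1
        by_contra hiS
        exact Finset.disjoint_left.1 h.2 (Finset.mem_sdiff.2 ⟨hF hi, hiS⟩) hi
    · split_ifs
      · exact le_rfl
      · simp
  simp_rw [fun F : Finset ι => (key (F \ S) S).tsum_eq] at hlim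
  rw [tsum_ite_eq] at hlim
  exact (tendsto_nhds_unique hlim tendsto_const_nhds)

theorem tprod_one_add_le_exp (h0 : ∀ i, 0 ≤ lam i) (h1 : ∀ i, lam i ≤ 1) (hs : Summable lam)
    {z : ℝ} (hz : 0 ≤ z) : ∏' i, (1 + (z - 1) * lam i) ≤ Real.exp ((z - 1) * ∑' i, lam i) := by
  have hm := Real.multipliable_one_add_of_summable (hs.mul_left (z - 1))
  have hexp : Tendsto (fun F : Finset ι => Real.exp ((z - 1) * ∑ i ∈ F, lam i)) atTop
      (𝓝 (Real.exp ((z - 1) * ∑' i, lam i))) :=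
    (Real.continuous_exp.tendsto _).comp (hs.hasSum.const_mul (z - 1))
  refine le_of_tendsto_of_tendsto' hm.hasProd hexp fun F => ?_
  rw [Finset.mul_sum, Real.exp_sum]
  refine Finset.prod_le_prod (fun i _ => ?_) fun i _ => ?_
  -- The factor is `(1 - lam i) + z * lam i`; nonnegativity is needed to compare products factor by
  -- factor.
  · nlinarith [h0 i, h1 i, mul_nonneg hz (h0 i)]
  · rw [add_comm]
    exact Real.add_one_le_exp _

open Classical in
/-- Chernoff bound for the distribution of the number of occupied modes. -/
theorem tsum_weight_card_le (h0 : ∀ i, 0 ≤ lam i) (h1 : ∀ i, lam i ≤ 1) (hs : Summable lam)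
    (k : ℕ) : ∑' S : Finset ι, (if S.card = k then weight lam S else 0) ≤
      (Real.exp 1 * ∑' i, lam i) ^ k / (k.factorial : ℝ) * Real.exp (-∑' i, lam i) := by
  set t := ∑' i, lam i with ht
  set q := ∑' S : Finset ι, (if S.card = k then weight lam S else 0) with hq
  have ht0 : 0 ≤ t := tsum_nonneg h0
  have hw := weight_nonneg h0 h1 hs
  -- Markov's inequality for `z^|S|`.
  have hchern (z : ℝ) (hz : 0 ≤ z) : z ^ k * q ≤ Real.exp ((z - 1) * t) := by
    refine le_trans ?_ (tprod_one_add_le_exp h0 h1 hs hz)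
    have hgf := hasSum_pow_mul_weight h0 h1 hs hz
    have hle (S : Finset ι) : z ^ k * (if S.card = k then weight lam S else 0) ≤
        z ^ S.card * weight lam S := by
      split_ifs with h
      · rw [h]
      · rw [mul_zero]
        exact mul_nonneg (pow_nonneg hz _) (hw S)
    rw [hq, ← tsum_mul_left, ← hgf.tsum_eq]
    refine Summable.tsum_le_tsum hle (Summable.of_nonneg_of_le (fun S => ?_) hle hgf.summable)
      hgf.summable
    split_ifs
    · exact mul_nonneg (pow_nonneg hz _) (hw S)
    · simp
  rcases Nat.eq_zero_or_pos k with rfl | hk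
  -- Here `z = 0` is optimal, with `0 ^ 0 = 1`.
  · simpa using hchern 0 le_rfl
  have hkf : (0 : ℝ) < k.factorial := by exact_mod_cast k.factorial_pos
  have hkR : (0 : ℝ) < k := by exact_mod_cast hk
  rcases ht0.eq_or_lt with h | h
  · rw [← h, mul_zero, zero_pow hk.ne', zero_div, zero_mul]
    by_contra! hpos
    -- For `t = 0` the bound reads `z ^ k * q ≤ 1` for all `z ≥ 0`; this choice makes the left side
    -- at least `q + 1`.
    have h2 := hchern (1 + 1 / q) (by positivity)
    rw [← h, mul_zero, Real.exp_zero] at h2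
    have h3 : 1 + 1 / q ≤ (1 + 1 / q) ^ k := by
      refine le_self_pow₀ ?_ hk.ne'
      have : 0 < 1 / q := by positivity
      linarith
    have h4 : (1 + 1 / q) * q ≤ (1 + 1 / q) ^ k * q := by gcongr
    have h5 : (1 + 1 / q) * q = q + 1 := by field_simp
    linarith
  -- The value `z = k / t` minimizes `z ^ (-k) * exp ((z - 1) * t)`; then `k! ≤ k ^ k` gives the
  -- stated form.
  · have h2 := hchern (k / t) (by positivity)
    have h3 : (k / t - 1) * t = k - t := by field_simp
    rw [h3] at h2
    have h4 : ((k.factorial : ℝ)) ≤ (k : ℝ) ^ k := by exact_mod_cast Nat.factorial_le_pow k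
    have h5 : q ≤ (t / k) ^ k * Real.exp (k - t) := by
      have h6 : (t / k) ^ k * ((k / t) ^ k * q) = q := by
        rw [← mul_assoc, ← mul_pow]
        have : t / k * (k / t) = 1 := by field_simp
        rw [this, one_pow, one_mul]
      rw [← h6]
      gcongr
    refine h5.trans ?_
    have h6 : (t / k) ^ k * Real.exp (k - t) =
        (Real.exp 1 * t) ^ k / (k : ℝ) ^ k * Real.exp (-t) := by
      rw [sub_eq_add_neg, Real.exp_add, mul_pow, div_pow, ← Real.exp_nat_mul, mul_one]
      ring
    rw [h6]
    gcongr

end Weights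

/-! ### The Fredholm determinant of a diagonalizable operator -/

section Fredholm

variable {H : Type u} [NormedAddCommGroup H] [InnerProductSpace ℂ H]

theorem inner_fockVec_ofFn {n : ℕ} (v w : Fin n → H) :
    ⟪fockVec (List.ofFn v), fockVec (List.ofFn w)⟫_ℂ =
      Matrix.det (Matrix.of fun i j => ⟪v i, w j⟫_ℂ) := by
  rw [fockVec_ofFn, fockVec_ofFn, inner_toFock, form_ιMulti]

theorem inner_fockVec_ofFn_of_ne {m n : ℕ} (h : m ≠ n) (v : Fin m → H) (w : Fin n → H) :
    ⟪fockVec (List.ofFn v), fockVec (List.ofFn w)⟫_ℂ = 0 := by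
  rw [fockVec_ofFn, fockVec_ofFn, inner_toFock_of_ne h]

/-- In the Gram determinant, row `i` acquires the factor `μ i`. -/
theorem inner_fockVec_map {κ : Type*} {b : κ → H} {μ : κ → ℂ} {T : H →L[ℂ] H}
    (hT : ∀ i x, ⟪b i, T x⟫_ℂ = μ i * ⟪b i, x⟫_ℂ) (l : List κ) (m : List H) :
    ⟪fockVec (l.map b), fockVec (m.map T)⟫_ℂ =
      (l.map μ).prod * ⟪fockVec (l.map b), fockVec m⟫_ℂ := by
  obtain ⟨n, v, rfl⟩ : ∃ n, ∃ v : Fin n → κ, List.ofFn v = l := ⟨_, _, List.ofFn_get l⟩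
  obtain ⟨n', w, rfl⟩ : ∃ n, ∃ w : Fin n → H, List.ofFn w = m := ⟨_, _, List.ofFn_get m⟩
  rw [List.map_ofFn, List.map_ofFn, List.map_ofFn, List.prod_ofFn]
  by_cases h : n = n'
  · subst h
    rw [inner_fockVec_ofFn, inner_fockVec_ofFn, ← Matrix.det_mul_column]
    congr 1
    ext i j
    simp [hT]
  · rw [inner_fockVec_ofFn_of_ne h, inner_fockVec_ofFn_of_ne h, mul_zero]

/-- A principal minor is a diagonal matrix element of an exterior power of `T`. Both vectors use the
same enumeration of `S`, so no sign appears. -/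
theorem det_eq_inner_fockVec {κ : Type*} [DecidableEq κ] (e : κ → H) (T : H →L[ℂ] H)
    (S : Finset κ) : Matrix.det (Matrix.of fun i j : S => ⟪e i.1, T (e j.1)⟫_ℂ) =
      ⟪occupation e S, fockVec ((S.toList.map e).map T)⟫_ℂ := by
  rw [occupation, List.map_map, ← List.ofFn_get S.toList, List.map_ofFn, List.map_ofFn,
    inner_fockVec_ofFn]
  let eq : Fin S.toList.length ≃ S :=
    (S.nodup_toList.getEquiv S.toList).trans (Equiv.subtypeEquivRight fun i => Finset.mem_toList)
  rw [← Matrix.det_submatrix_equiv_self eq]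
  rfl

open Classical in
/-- The principal minors of a diagonalizable operator, in any Hilbert basis, sum up to the product
`∏ᵢ (1 + μᵢ)` over its eigenvalues. -/
theorem hasSum_det {κ κ' : Type*} (b : HilbertBasis κ ℂ H) (e : HilbertBasis κ' ℂ H) {μ : κ → ℝ}
    (hμ : Summable μ) {T : H →L[ℂ] H} (hT : ∀ i x, ⟪b i, T x⟫_ℂ = (μ i : ℂ) * ⟪b i, x⟫_ℂ) :
    HasSum (fun S : Finset κ' => Matrix.det (Matrix.of fun i j : S => ⟪e i.1, T (e j.1)⟫_ℂ))
      ((∏' i, (1 + μ i) : ℝ) : ℂ) := by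
  let M : Finset κ → ℝ := fun L => ∏ i ∈ L, μ i
  have hMs : Summable fun L => |M L| := by
    have := summable_finsetProd_of_summable_nonneg (fun i => abs_nonneg (μ i)) hμ.abs
    simpa only [M, Finset.abs_prod] using this
  -- Cauchy–Binet as a double series: by Parseval the sum over `S` is `∏ i ∈ L, μ i`, while the sum
  -- over `L` is the minor of `S`. The `μ i` may be negative, so summability is checked on absolute
  -- values.
  let f : Finset κ × Finset κ' → ℝ := fun p =>
    M p.1 * ‖⟪occupation e p.2, occupation b p.1⟫_ℂ‖ ^ 2
  have hrow' (L : Finset κ) :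
      HasSum (fun S => ‖⟪occupation e S, occupation b L⟫_ℂ‖ ^ 2) 1 := by
    have h := hasSum_norm_sq_inner (fockBasis e) (occupation b L)
    rw [(orthonormal_occupation b.orthonormal).1 L, one_pow] at h
    simpa only [fockBasis_apply] using h
  have hrow (L : Finset κ) : HasSum (fun S => f (L, S)) (M L) := by
    simpa using (hrow' L).mul_left (M L)
  have hsum : Summable f := by
    rw [← summable_abs_iff]
    have habs (p : Finset κ × Finset κ') :
        |f p| = |M p.1| * ‖⟪occupation e p.2, occupation b p.1⟫_ℂ‖ ^ 2 := by
      simp only [f]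
      rw [abs_mul, abs_of_nonneg (sq_nonneg ‖⟪occupation e p.2, occupation b p.1⟫_ℂ‖)]
    refine (summable_prod_of_nonneg fun p => abs_nonneg _).2 ⟨fun L => ?_, hMs.congr fun L => ?_⟩
    · simp only [habs]
      exact ((hrow' L).mul_left _).summable
    · simp only [habs]
      rw [((hrow' L).mul_left _).tsum_eq, mul_one]
  have hcol (S : Finset κ') : HasSum (fun L => ((f (L, S) : ℝ) : ℂ))
      (Matrix.det (Matrix.of fun i j : S => ⟪e i.1, T (e j.1)⟫_ℂ)) := by
    rw [det_eq_inner_fockVec]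
    refine (hasSum_congr fun L => ?_).mp ((fockBasis b).hasSum_inner_mul_inner _ _)
    rw [fockBasis_apply, occupation, occupation, inner_fockVec_map hT]
    have hM : (L.toList.map fun i => (μ i : ℂ)).prod = (M L : ℂ) := by
      rw [Finset.prod_map_toList]
      simp [M]
    rw [hM, mul_left_comm, inner_mul_inner_swap, norm_inner_symm]
    simp only [f, occupation]
    push_cast
    rfl
  have h1 := hsum.hasSum.prod_fiberwise hrow
  have htot : ∏' i, (1 + μ i) = ∑' p, f p := by
    rw [tprod_one_add hMs.of_abs]
    exact h1.tsum_eq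
  rw [htot]
  exact (((Equiv.prodComm (Finset κ') (Finset κ)).hasSum_iff.2
    (Complex.hasSum_ofReal.2 hsum.hasSum))).prod_fiberwise hcol

theorem fredholmDet_eq_tprod [CompleteSpace H] {κ : Type*} (b : HilbertBasis κ ℂ H) {μ : κ → ℝ}
    (hμ : Summable μ) {T : H →L[ℂ] H} (hT : ∀ i x, ⟪b i, T x⟫_ℂ = (μ i : ℂ) * ⟪b i, x⟫_ℂ) :
    fredholmDet T = ((∏' i, (1 + μ i) : ℝ) : ℂ) := by
  classical
  have h := hasSum_det b (onb H) hμ hT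
  -- The absolutely convergent sum over all finite sets is grouped by cardinality.
  have h1 := (Equiv.sigmaFiberEquiv (Finset.card (α := basisIndex H))).hasSum_iff.2 h
  rw [← h1.tsum_eq, h1.summable.tsum_sigma]
  refine tsum_congr fun k => ?_
  refine tsum_congr fun S => ?_
  simp only [Function.comp_apply]
  congr!

end Fredholm

/-! ### Density of the words and continuity of states -/

section Density

variable {H : Type u} [NormedAddCommGroup H] [InnerProductSpace ℂ H] {ι : Type*}

theorem word_append (b : ι → H) (w w' : List (ι × Bool)) :
    word b (w ++ w') = word b w * word b w' := by
  rw [word, List.map_append, List.prod_append]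
  rfl

theorem coe_word_mem_of_mem_closure (b : ι → H) {A : Fock H →L[ℂ] Fock H}
    (hA : A ∈ Submonoid.closure (Set.range (fun i => creation (b i)) ∪
      star (Set.range fun i => creation (b i)))) :
    ∃ w : List (ι × Bool), (word b w : Fock H →L[ℂ] Fock H) = A := by
  induction hA using Submonoid.closure_induction with
  | mem A hA =>
    rcases hA with ⟨i, rfl⟩ | ⟨i, hi⟩
    · refine ⟨[(i, true)], ?_⟩
      rw [word_cons, word_nil, mul_one, field_true, coe_aStar]
    · refine ⟨[(i, false)], ?_⟩
      rw [word_cons, word_nil, mul_one, field_false, coe_aOp, ← star_star A, ← hi]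
      rfl
  | one => exact ⟨[], rfl⟩
  | mul A B _ _ hA hB =>
    obtain ⟨w, rfl⟩ := hA
    obtain ⟨w', rfl⟩ := hB
    exact ⟨w ++ w', by rw [word_append]; rfl⟩

theorem coe_mem_span_word (b : ι → H) {A : Fock H →L[ℂ] Fock H}
    (hA : A ∈ StarAlgebra.adjoin ℂ (Set.range fun i => creation (b i))) :
    A ∈ Submodule.span ℂ (Set.range fun w => (word b w : Fock H →L[ℂ] Fock H)) := by
  have h : A ∈ Subalgebra.toSubmodule
      (StarAlgebra.adjoin ℂ (Set.range fun i => creation (b i))).toSubalgebra := hA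
  rw [StarAlgebra.adjoin_toSubalgebra, Algebra.adjoin_eq_span] at h
  refine Submodule.span_mono (fun B hB => ?_) h
  exact coe_word_mem_of_mem_closure b hB

/-- The map `f ↦ a*(f)` is linear and norm continuous, so a closed algebra containing the creation
operators of a basis contains all of them. -/
theorem CAR_le (b : HilbertBasis ι ℂ H) :
    CAR H ≤ (StarAlgebra.adjoin ℂ (Set.range fun i => creation (b i))).topologicalClosure := by
  set A₀ := StarAlgebra.adjoin ℂ (Set.range fun i => creation (b i)) with hA₀
  have hcl : IsClosed (A₀.topologicalClosure : Set (Fock H →L[ℂ] Fock H)) :=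
    A₀.isClosed_topologicalClosure
  refine StarSubalgebra.topologicalClosure_minimal (StarAlgebra.adjoin_le ?_) hcl
  rintro _ ⟨f, rfl⟩
  let V : Submodule ℂ (Fock H →L[ℂ] Fock H) :=
    Subalgebra.toSubmodule A₀.topologicalClosure.toSubalgebra
  have h1 : (Submodule.span ℂ (Set.range b)).topologicalClosure ≤
      V.comap (creationCLM (H := H)).toLinearMap := by
    refine Submodule.topologicalClosure_minimal _ ?_
      (hcl.preimage (creationCLM (H := H)).continuous)
    rw [Submodule.span_le]
    rintro _ ⟨i, rfl⟩
    exact A₀.le_topologicalClosure (StarAlgebra.subset_adjoin ℂ _ ⟨i, rfl⟩)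
  rw [b.dense_span] at h1
  exact h1 (Submodule.mem_top : f ∈ ⊤)

theorem dense_span_word (b : HilbertBasis ι ℂ H) :
    Dense (Submodule.span ℂ (Set.range (word b)) : Set (CAR H)) := by
  intro A
  rw [closure_subtype]
  refine closure_mono ?_ (CAR_le b A.2)
  intro B hB
  have h := coe_mem_span_word b hB
  have hmap : Submodule.span ℂ (Set.range fun w => (word b w : Fock H →L[ℂ] Fock H)) =
      (Submodule.span ℂ (Set.range (word b))).map (CAR H).subtype.toLinearMap := by
    rw [Submodule.map_span, ← Set.range_comp]
    rfl
  rw [hmap] at h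
  obtain ⟨C, hC, rfl⟩ := h
  exact ⟨C, hC, rfl⟩

theorem eq_zero_of_word (b : HilbertBasis ι ℂ H) {φ : CAR H →ₗ[ℂ] ℂ} (hφ : Continuous φ)
    (h : ∀ w, φ (word b w) = 0) (A : CAR H) : φ A = 0 := by
  have hcl : IsClosed {A | φ A = 0} := isClosed_eq hφ continuous_const
  refine (dense_span_word b).induction (P := fun A => φ A = 0) ?_ hcl A
  intro B hB
  induction hB using Submodule.span_induction with
  | mem B hB =>
    obtain ⟨w, rfl⟩ := hB
    exact h w
  | zero => exact map_zero φ
  | add B C _ _ hB hC => rw [map_add, hB, hC, add_zero]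
  | smul c B _ hB => rw [map_smul, hB, smul_zero]

/-- Positive functionals on a C*-algebra are bounded; in the spectral order the non-negative
elements are exactly the `B* B`. -/
theorem IsState.continuous {ω : CAR H →ₗ[ℂ] ℂ} (hω : IsState ω) : Continuous ω := by
  have hcl : IsClosed (CAR H : Set (Fock H →L[ℂ] Fock H)) :=
    StarSubalgebra.isClosed_topologicalClosure _
  let _ : CStarAlgebra (CAR H) := StarSubalgebra.cstarAlgebra (CAR H)
  let _ : PartialOrder (CAR H) := CStarAlgebra.spectralOrder (CAR H)
  let _ : StarOrderedRing (CAR H) := CStarAlgebra.spectralOrderedRing (CAR H)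
  let f : CAR H →ₚ[ℂ] ℂ := PositiveLinearMap.mk₀ ω fun A hA => by
    obtain ⟨B, rfl⟩ := CStarAlgebra.nonneg_iff_eq_star_mul_self.1 hA
    exact hω.nonneg B
  obtain ⟨C, hC⟩ := f.exists_norm_apply_le
  exact AddMonoidHomClass.continuous_of_bound ω C hC

end Density

/-! ### Norm-convergent mixtures of vector functionals -/

section Normal

variable {E : Type u} [NormedAddCommGroup E] [InnerProductSpace ℂ E]

/-- The functional `A ↦ ⟨u, A u⟩`. -/
noncomputable def vectorFunctional (u : E) : (E →L[ℂ] E) →L[ℂ] ℂ :=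
  (innerSL ℂ u).comp (ContinuousLinearMap.apply ℂ E u)

theorem vectorFunctional_apply (u : E) (A : E →L[ℂ] E) : vectorFunctional u A = ⟪u, A u⟫_ℂ := rfl

theorem norm_vectorFunctional_le {u : E} (hu : ‖u‖ = 1) : ‖vectorFunctional u‖ ≤ 1 := by
  refine ContinuousLinearMap.opNorm_le_bound _ zero_le_one fun A => ?_
  have h1 := norm_inner_le_norm (𝕜 := ℂ) u (A u)
  have h2 := A.le_opNorm u
  rw [hu, one_mul] at h1
  rw [hu, mul_one] at h2
  rw [vectorFunctional_apply, one_mul]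
  exact h1.trans h2

/-- The series converges in the dual norm, so the mixture is continuous, as the density argument
requires. -/
theorem exists_hasSum_functional {κ V : Type*} [NormedAddCommGroup V] [NormedSpace ℂ V]
    {F : κ → V →L[ℂ] ℂ} (hF : ∀ j, ‖F j‖ ≤ 1) {t : κ → ℝ} (ht : ∀ j, 0 ≤ t j) (hts : Summable t) :
    ∃ Φ : V →L[ℂ] ℂ, ∀ A, HasSum (fun j => (t j : ℂ) * F j A) (Φ A) := by
  have hs : Summable fun j => (t j : ℂ) • F j := by
    refine hts.of_norm_bounded fun j => ?_
    rw [norm_smul, Complex.norm_real, Real.norm_eq_abs, abs_of_nonneg (ht j)]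
    exact mul_le_of_le_one_right (ht j) (hF j)
  exact ⟨_, fun A => hs.hasSum.mapL (ContinuousLinearMap.apply ℂ ℂ A)⟩

theorem exists_hasSum_vectorFunctional {κ : Type*} {u : κ → E} (hu : ∀ j, ‖u j‖ = 1) {t : κ → ℝ}
    (ht : ∀ j, 0 ≤ t j) (hts : Summable t) :
    ∃ Φ : (E →L[ℂ] E) →L[ℂ] ℂ, ∀ A, HasSum (fun j => (t j : ℂ) * ⟪u j, A (u j)⟫_ℂ) (Φ A) :=
  exists_hasSum_functional (fun j => norm_vectorFunctional_le (hu j)) ht hts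

end Normal

/-! ### The density matrix and its diagonal -/

section Main

variable {H : Type u} [NormedAddCommGroup H] [InnerProductSpace ℂ H] {ι : Type*}
  {ω : CAR H →ₗ[ℂ] ℂ} {γ : H →L[ℂ] H} {lam : ι → ℝ}

theorem IsOnePDM.inner_nonneg (hω : IsState ω) (hγ : IsOnePDM ω γ) (f : H) :
    0 ≤ ⟪f, γ f⟫_ℂ := by
  rw [hγ, ← star_aOp]
  exact hω.nonneg _

theorem IsOnePDM.isPositive (hω : IsState ω) (hγ : IsOnePDM ω γ) : γ.IsPositive := by
  rw [ContinuousLinearMap.isPositive_iff_complex]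
  intro f
  have h := Complex.nonneg_iff.1 (hγ.inner_nonneg hω f)
  rw [← inner_conj_symm]
  exact ⟨Complex.ext (by simp) (by rw [Complex.conj_im, ← h.2]; simp), h.1⟩

/-- The Pauli principle: `0 ≤ ω(a(bᵢ) a*(bᵢ)) = 1 - lam i`. -/
theorem IsDiagonalTwoPoint.le_one (hω : IsState ω) {b : ι → H} (hb : Orthonormal ℂ b)
    (h2 : IsDiagonalTwoPoint ω b lam) (i : ι) : lam i ≤ 1 := by
  have h := hω.nonneg (aStar (b i))
  rw [star_aStar, aOp_mul_aStar, map_sub, map_smul, hω.map_one, h2.number,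
    inner_self_eq_norm_sq_to_K, hb.1 i] at h
  have h' := (Complex.nonneg_iff.1 h).1
  simpa using h'

theorem IsQuasiFree.exists_isDensityMatrix [CompleteSpace H] (hω : IsQuasiFree ω)
    (b : HilbertBasis ι ℂ H) (h2 : IsDiagonalTwoPoint ω b lam) (h0 : ∀ i, 0 ≤ lam i)
    (hs : Summable lam) : ∃ G : Fock H →L[ℂ] Fock H, IsDensityMatrix ω G := by
  classical
  have h1 := h2.le_one hω.toIsState b.orthonormal
  have hw := weight_nonneg h0 h1 hs
  -- Normalization is the case of an empty set of prescribed modes.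
  have hws : HasSum (weight lam) 1 := by simpa using hasSum_weight_of_subset h0 h1 hs ∅
  have hu := (fockBasis b).orthonormal.1
  obtain ⟨G, hG, hGtr, hGv⟩ := exists_isPositive_of_eigenvalues (fockBasis b) hw hws.summable
  obtain ⟨Φ, hΦ⟩ := exists_hasSum_vectorFunctional hu hw hws.summable
  have htr (A : Fock H →L[ℂ] Fock H) : trace (G * A) = Φ A := by
    rw [trace_mul_of_eigenvectors _ hw hws.summable hG hGv, (hΦ A).tsum_eq]
  refine ⟨G, hG, hGtr, ?_, fun A => ?_⟩
  · rw [trace_of_eigenvectors _ hw hws.summable hG hGv]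
    exact_mod_cast (Complex.hasSum_ofReal.2 hws).tsum_eq
  rw [htr]
  -- This difference is continuous, so it suffices that it vanishes on charged words and on products
  -- of distinct number operators.
  let ψ : CAR H →ₗ[ℂ] ℂ := ω - Φ.toLinearMap ∘ₗ (CAR H).subtype.toLinearMap
  have hψ (A : CAR H) : ψ A = ω A - Φ A := rfl
  have hcont : Continuous ψ :=
    hω.toIsState.continuous.sub (Φ.continuous.comp continuous_subtype_val)
  refine sub_eq_zero.1 (eq_zero_of_word b hcont (fun w => ?_) A)
  refine apply_word_eq_zero ψ (fun i w hiw => ?_) (fun ks hks => ?_) w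
  · rw [hψ, hω.apply_word_eq_zero_of_charge h2 i w hiw, zero_sub, neg_eq_zero]
    refine (hΦ _).unique ?_
    refine (hasSum_congr fun S => ?_).mp hasSum_zero
    rw [fockBasis_apply, inner_word_occupation_of_charge b.orthonormal hiw, mul_zero]
  · rw [hψ, hω.apply_numberWord h2 hks, sub_eq_zero, eq_comm]
    refine (hΦ _).unique ?_
    have h3 := Complex.hasSum_ofReal.2 (hasSum_weight_of_subset h0 h1 hs ks.toFinset)
    rw [List.prod_toFinset _ hks] at h3
    refine (hasSum_congr fun S => ?_).mp h3
    rw [fockBasis_apply, numberWord_occupation b.orthonormal]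
    have hiff : (∀ k ∈ ks, k ∈ S) ↔ ks.toFinset ⊆ S := by simp [Finset.subset_iff]
    by_cases h : ks.toFinset ⊆ S
    · have := (orthonormal_occupation b.orthonormal).1 S
      rw [if_pos h, if_pos (hiff.2 h), inner_self_eq_norm_sq_to_K, this]
      simp
    · rw [if_neg h, if_neg (mt hiff.1 h)]
      simp

/-- A density matrix of a quasi-free state has prescribed diagonal elements in the occupation
number basis. -/
theorem IsQuasiFree.inner_occupation (hω : IsQuasiFree ω)
    (b : HilbertBasis ι ℂ H) (h2 : IsDiagonalTwoPoint ω b lam) (h0 : ∀ i, 0 ≤ lam i)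
    (hs : Summable lam) {G : Fock H →L[ℂ] Fock H} (hG : IsDensityMatrix ω G) (S : Finset ι) :
    ⟪occupation b S, G (occupation b S)⟫_ℂ = weight lam S := by
  classical
  have h1 := h2.le_one hω.toIsState b.orthonormal
  let q : Finset ι → ℝ := fun L => (⟪occupation b L, G (occupation b L)⟫_ℂ).re
  have hq (L : Finset ι) : ⟪occupation b L, G (occupation b L)⟫_ℂ = q L := by
    have := (Complex.nonneg_iff.1 (hG.nonneg.inner_nonneg_right (occupation b L))).2
    exact Complex.ext (by simp [q]) (by simp [← this])
  -- The product of the number operators in `K` projects onto the occupation vectors with `K ⊆ L`,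
  -- and Wick's formula gives its expectation.
  have hsup (K : Finset ι) : HasSum (fun L => if K ⊆ L then q L else 0) (∏ i ∈ K, lam i) := by
    have h := hasSum_trace_mul hG.nonneg hG.traceClass (fockBasis b)
      (word b (numberWord K.toList) : Fock H →L[ℂ] Fock H)
    rw [← hG.apply_eq, hω.apply_numberWord h2 K.nodup_toList, Finset.prod_map_toList] at h
    rw [← Complex.hasSum_ofReal]
    refine (hasSum_congr fun L => ?_).mp h
    rw [fockBasis_apply, numberWord_occupation b.orthonormal]
    simp only [Finset.mem_toList, ← Finset.subset_iff]
    split_ifs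
    · exact hq L
    · simp
  have hd := eq_zero_of_hasSum_superset (d := fun L => q L - weight lam L) (fun K => by
    have h := (hsup K).sub (hasSum_weight_of_subset h0 h1 hs K)
    rw [sub_self] at h
    refine (hasSum_congr fun L => ?_).mp h
    split_ifs <;> simp) S
  rw [hq, sub_eq_zero.1 hd]

/-- Functions of the particle number are diagonal in the occupation basis, so only the diagonal of
`G` enters, and `ω` determines it. -/
theorem IsQuasiFree.hasSum_trace_numberFunction (hω : IsQuasiFree ω)
    (b : HilbertBasis ι ℂ H) (h2 : IsDiagonalTwoPoint ω b lam) (h0 : ∀ i, 0 ≤ lam i)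
    (hs : Summable lam) {G : Fock H →L[ℂ] Fock H} (hG : IsDensityMatrix ω G) (c : ℕ → ℂ)
    (hc : ∀ n, ‖c n‖ ≤ 1) :
    HasSum (fun S : Finset ι => c S.card * weight lam S) (trace (G * numberFunction c hc)) := by
  refine (hasSum_congr fun S => ?_).mp
    (hasSum_trace_mul hG.nonneg hG.traceClass (fockBasis b) (numberFunction c hc))
  rw [fockBasis_apply, numberFunction_occupation, map_smul, inner_smul_right,
    hω.inner_occupation b h2 h0 hs hG]

/-- A fixed vector of `γ` has no component along modes with eigenvalue other than 1, so it lies in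
the span of the modes in `S`. -/
theorem finrank_ker_sub_one_le (b : HilbertBasis ι ℂ H)
    (hγ : ∀ i x, ⟪b i, γ x⟫_ℂ = (lam i : ℂ) * ⟪b i, x⟫_ℂ) {S : Finset ι}
    (hS : ∀ i ∉ S, lam i ≠ 1) :
    Module.finrank ℂ (LinearMap.ker ((γ - 1 : H →L[ℂ] H) : H →ₗ[ℂ] H)) ≤ S.card := by
  classical
  have hle : LinearMap.ker ((γ - 1 : H →L[ℂ] H) : H →ₗ[ℂ] H) ≤
      Submodule.span ℂ (S.image b : Set H) := by
    intro x hx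
    have hx' : γ x = x := by
      have : γ x - x = 0 := hx
      exact sub_eq_zero.1 this
    have hz (i : ι) (hi : i ∉ S) : ⟪b i, x⟫_ℂ = 0 := by
      have h := hγ i x
      rw [hx'] at h
      have h3 : ((lam i : ℂ) - 1) * ⟪b i, x⟫_ℂ = 0 := by rw [sub_mul, ← h, one_mul, sub_self]
      rcases mul_eq_zero.1 h3 with h4 | h4
      · exact absurd (by exact_mod_cast sub_eq_zero.1 h4) (hS i hi)
      · exact h4
    have hsum := b.hasSum_repr x
    have hfin : HasSum (fun i => b.repr x i • b i) (∑ i ∈ S, b.repr x i • b i) :=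
      hasSum_sum_of_ne_finset_zero fun i hi => by rw [b.repr_apply_apply, hz i hi, zero_smul]
    rw [hsum.unique hfin]
    refine sum_mem fun i hi => Submodule.smul_mem _ _ (Submodule.subset_span ?_)
    exact Finset.mem_coe.2 (Finset.mem_image_of_mem b hi)
  calc Module.finrank ℂ (LinearMap.ker ((γ - 1 : H →L[ℂ] H) : H →ₗ[ℂ] H))
      ≤ Module.finrank ℂ (Submodule.span ℂ (S.image b : Set H)) := Submodule.finrank_mono hle
    _ ≤ (S.image b).card := finrank_span_finset_le_card _
    _ ≤ S.card := Finset.card_image_le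

end Main

end QuasiFree

/-! ### Assembly in an eigenbasis of the one-particle density matrix -/

theorem proposition2p2 {H : Type*} [NormedAddCommGroup H] [InnerProductSpace ℂ H]
    [CompleteSpace H] [TopologicalSpace.SeparableSpace H]
    {K : Type*} [NormedAddCommGroup K] [InnerProductSpace ℂ K] [CompleteSpace K]
    (J : H →ₛₗᵢ[starRingEnd ℂ] K)
    (ω : QuasiFree.CAR H →ₗ[ℂ] ℂ) (hω : QuasiFree.IsQuasiFree ω)
    (γ : H →L[ℂ] H) (hγ : QuasiFree.IsOnePDM ω γ)
    (α : K →L[ℂ] H) (hα : QuasiFree.IsPairingMatrix J ω α)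
    (hγtr : QuasiFree.IsTraceClass γ) (hα0 : α = 0) :
    (∃ G : QuasiFree.Fock H →L[ℂ] QuasiFree.Fock H, QuasiFree.IsDensityMatrix ω G) ∧
    ∀ G : QuasiFree.Fock H →L[ℂ] QuasiFree.Fock H, QuasiFree.IsDensityMatrix ω G →
      (∀ β : NNReal, QuasiFree.trace (G * QuasiFree.expNegNumber β) =
        QuasiFree.fredholmDet (((Real.exp (-β) - 1 : ℝ) : ℂ) • γ)) ∧
      (∀ k : ℕ, Module.finrank ℂ (LinearMap.ker ((γ - 1 : H →L[ℂ] H) : H →ₗ[ℂ] H)) ≤ k →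
        QuasiFree.trace (G * QuasiFree.sectorProjection k) ≤
          (((Real.exp 1 * (QuasiFree.trace γ).re) ^ k / (k.factorial : ℝ) *
            Real.exp (-(QuasiFree.trace γ).re) : ℝ) : ℂ)) ∧
      (∀ k : ℕ, k < Module.finrank ℂ (LinearMap.ker ((γ - 1 : H →L[ℂ] H) : H →ₗ[ℂ] H)) →
        QuasiFree.trace (G * QuasiFree.sectorProjection k) = 0) := by
  classical
  have hαα : ∀ f g, ω (QuasiFree.aStar f * QuasiFree.aStar g) = 0 := fun f g => by
    rw [← hα, hα0, zero_apply, inner_zero_left]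
  have hpos := hγ.isPositive hω.toIsState
  obtain ⟨ι, b, lam, h0, hs, hv⟩ := QuasiFree.exists_eigenbasis hpos hγtr
  have h2 := QuasiFree.isDiagonalTwoPoint hω.toIsState hγ hαα b.orthonormal hv
  have h1 := h2.le_one hω.toIsState b.orthonormal
  have hin (i : ι) (x : H) : ⟪b i, γ x⟫_ℂ = (lam i : ℂ) * ⟪b i, x⟫_ℂ := by
    have h := hpos.isSymmetric (b i) x
    simp only [ContinuousLinearMap.coe_coe] at h
    rw [← h, hv, inner_smul_left, Complex.conj_ofReal]
  have htrγ : (QuasiFree.trace γ).re = ∑' i, lam i := by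
    rw [QuasiFree.trace_of_eigenvectors b h0 hs hpos hv, ← Complex.ofReal_tsum, Complex.ofReal_re]
  refine ⟨hω.exists_isDensityMatrix b h2 h0 hs, fun G hG => ?_⟩
  have hsector (k : ℕ) : HasSum (fun S : Finset ι =>
      ((if S.card = k then QuasiFree.weight lam S else 0 : ℝ) : ℂ))
      (QuasiFree.trace (G * QuasiFree.sectorProjection k)) := by
    refine (QuasiFree.hasSum_congr fun S => ?_).mp
      (hω.hasSum_trace_numberFunction b h2 h0 hs hG _ _)
    split_ifs <;> simp
  refine ⟨fun β => ?_, fun k _ => ?_, fun k hk => ?_⟩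
  · have hdet := QuasiFree.fredholmDet_eq_tprod b (μ := fun i => (Real.exp (-β) - 1) * lam i)
      (hs.mul_left _) (T := ((Real.exp (-β) - 1 : ℝ) : ℂ) • γ) fun i x => by
        rw [smul_apply, inner_smul_right, hin, Complex.ofReal_mul, mul_assoc]
    rw [hdet]
    refine (hω.hasSum_trace_numberFunction b h2 h0 hs hG _ _).unique ?_
    refine (QuasiFree.hasSum_congr fun S => ?_).mp (Complex.hasSum_ofReal.2
      -- The generating function is evaluated at `z = e^{-β}`.
      (QuasiFree.hasSum_pow_mul_weight h0 h1 hs (Real.exp_nonneg (-β))))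
    rw [← Real.exp_nat_mul, Complex.ofReal_mul]
    congr 3
    ring
  · rw [← (hsector k).tsum_eq, ← Complex.ofReal_tsum, htrγ, Complex.real_le_real]
    exact QuasiFree.tsum_weight_card_le h0 h1 hs k
  · refine (hsector k).unique ?_
    refine (QuasiFree.hasSum_congr fun S => ?_).mp hasSum_zero
    split_ifs with hS
    -- Otherwise `S` would contain all modes with eigenvalue 1, and the kernel would have dimension
    -- at most `|S| = k`.
    · have : ∃ i, i ∉ S ∧ lam i = 1 := by
        by_contra! hne
        exact absurd (QuasiFree.finrank_ker_sub_one_le b hin hne) (by omega)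
      obtain ⟨i, hi, hi1⟩ := this
      rw [QuasiFree.weight_eq_zero hi1 hi, Complex.ofReal_zero]
    · rfl
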